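/- Let $N,M\ge 1$ be integers, $\alpha>0$ and $t\ge 0$. Consider the multi-color half-space TASEP on the sites $\mathbb{Z}\setminus\{0\}$: a configuration assigns to each site a color, the colors are linearly ordered, and $+\infty$ is the color of a hole. To "sort" a pair of sites $(x,y)$ with $x<y$ means to exchange their contents if the color at $x$ is strictly smaller than the color at $y$, and to do nothing otherwise. The process is the continuous-time càdlàg Markov process in which, independently, at rate $\alpha$ the pair $(-1,1)$ is sorted, and for every $x\ge 1$, at rate $1$, the pairs $(x,x+1)$ and $(-x-1,-x)$ are sorted simultaneously (i.e. it solves the martingale problem for the corresponding generator on bounded functions depending on finitely many sites). Let $\xi_t$, $\tilde\xi_t$ and $\eta^{\mathrm{step}}_t$ be such processes with the deterministic initial conditions $$\xi_0(x)=\begin{cases}1,& x\le -1\text{ or }N+1\le x\le N+M\text{ or }N+2M+2\le x\le 2N+2M+1,\\ 2,& x=N+2M+1,\\ +\infty,&\text{otherwise,}\end{cases}$$ $$\tilde\xi_0(x)=\begin{cases}1,& x\le -1,\\ 2,& N+1\le x\le N+M,\\ 3,& N+2M+1\le x\le 2N+2M+1,\\ +\infty,&\text{otherwise,}\end{cases}\qquad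 \eta^{\mathrm{step}}_0(x)=\begin{cases}1,& x\le -1,\\ +\infty,& x\ge 1.\end{cases}$$ Let $g(t)$ be the position of the unique particle of color $2$ in $\xi_t$ (so $g(t)<0$ means that it has disappeared from the half-line $\{1,2,\dots\}$), let $\mathsf N_i(x,t)$, $i\in\{1,2,3\}$, be the number of particles of color $i$ in $\tilde\xi_t$ at sites $\ge x$, and let $\mathcal N(x,t)$ be the number of particles of color $1$ in $\eta^{\mathrm{step}}_t$ at sites $\ge x$. Then almost surely $\xi_t$ has exactly one particle of color $2$, and there are only finitely many particles at sites $\ge 1$ in $\tilde\xi_t$ and in $\eta^{\mathrm{step}}_t$. Moreover $$\mathbb P\bigl(g(t)<0\bigr)=\mathbb P\Bigl(\mathcal N(N+M+1,t)-\mathcal N(2N+2M+2,t)+\min\{N,\ \mathcal N(1,t)-\mathcal N(N+M+1,t)\}\ \ge\ N+M+1\Bigr),$$ and the following equality in (joint) distribution holds: $$\begin{aligned}\bigl(\mathsf N_1(1,t),\mathsf N_2(1,t),\mathsf N_3(1,t)\bigr)\overset{d}{=}\Bigl(&\mathcal N(1,t),\ \min\bigl\{M,\ M+N-\mathcal N(1,t)+\mathcal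 N(M+N+1,t)\bigr\},\\ &\min\bigl\{N+1,\ M+N+1-\mathcal N(M+N+1,t)+\mathcal N(2M+2N+2,t)\\ &\qquad\qquad+\max\{0,\ N-\mathcal N(1,t)+\mathcal N(M+N+1,t)\}\bigr\}\Bigr).\end{aligned}$$ -/

import Mathlib

open MeasureTheory ProbabilityTheory Filter Topology
open scoped NNReal ENNReal

namespace HalfSpaceTASEP

/-- The sites of the half-space model: `ℕ ∪ -ℕ = {…, -2, -1, 1, 2, …}`. -/
abbrev Site : Type := {x : ℤ // x ≠ 0}

/-- A configuration assigns to each site a color; smaller colors are stronger,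
and the color `⊤ = +∞` is a hole. -/
abbrev Config : Type := Site → ℕ∞

/-- The site `k + 1`. -/
def pos (k : ℕ) : Site := ⟨(k : ℤ) + 1, by omega⟩

/-- The site `-(k + 1)`. -/
def neg (k : ℕ) : Site := ⟨-((k : ℤ) + 1), by omega⟩

/-- The contents of the two sites `a` (left) and `b` (right) are exchanged if the color at `a`
is strictly smaller than the color at `b`; otherwise nothing happens. -/
def swapIfLT (a b : Site) (η : Config) : Config :=
  if η a < η b then η ∘ Equiv.swap a b else η

/-- The effect of a ring of the clock number `k`. The clock `0` sits on the edge `(-1, 1)`; the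
clock `k + 1` sits on the edge `(k + 1, k + 2)` and simultaneously on its mirror image
`(-(k + 2), -(k + 1))`. -/
def update : ℕ → Config → Config
  | 0, η => swapIfLT (neg 0) (pos 0) η
  | k + 1, η => swapIfLT (neg (k + 1)) (neg k) (swapIfLT (pos k) (pos (k + 1)) η)

/-- The rates of the clocks: `α` on the edge `(-1, 1)`, and `1` on all the others. -/
def rate (α : ℝ) : ℕ → ℝ
  | 0 => α
  | _ + 1 => 1

/-- A function of the configuration that depends on finitely many sites only. -/
def IsLocal (f : Config → ℝ) : Prop :=
  ∃ n : ℕ, DependsOn f {x : Site | |(x : ℤ)| ≤ n}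

/-- The generator of the half-space TASEP. For a local function `f` only finitely many
terms of the sum are nonzero. -/
noncomputable def generator (α : ℝ) (f : Config → ℝ) (η : Config) : ℝ :=
  ∑' k : ℕ, rate α k * (f (update k η) - f η)

/-- `ξ` is a multi-color half-space TASEP with reservoir rate `α` started from `η₀`, that is, the
continuous-time Markov process with the above generator: a càdlàg process (colors are discrete,
so each site is a right-continuous step function with left limits) which solves the martingale
problem for the generator on bounded local functions. -/
structure IsHalfSpaceTASEP (α : ℝ) (η₀ : Config) {Ω : Type*} [mΩ : MeasurableSpace Ω]
    (P : Measure Ω) (ξ : ℝ≥0 → Ω → Config) : Prop where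
  init : ∀ᵐ ω ∂P, ξ 0 ω = η₀
  right_continuous : ∀ (ω : Ω) (x : Site) (t : ℝ≥0), ∀ᶠ s in 𝓝[>] t, ξ s ω x = ξ t ω x
  left_limits : ∀ (ω : Ω) (x : Site) (t : ℝ≥0), ∃ c : ℕ∞, ∀ᶠ s in 𝓝[<] t, ξ s ω x = c
  martingale : ∃ ℱ : Filtration ℝ≥0 mΩ,
    (∀ (t : ℝ≥0) (x : Site), Measurable[ℱ t] fun ω => ξ t ω x) ∧
    ∀ f : Config → ℝ, IsLocal f → (∃ B : ℝ, ∀ η, |f η| ≤ B) →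
      Martingale (fun (t : ℝ≥0) (ω : Ω) =>
        f (ξ t ω) - ∫ s in (0 : ℝ)..(t : ℝ), generator α f (ξ s.toNNReal ω)) ℱ P

/-- Step initial condition: particles on the negative sites, holes on the positive ones. -/
noncomputable def stepInit : Config := fun x => if (x : ℤ) ≤ -1 then 1 else ⊤

/-- The three-color two-shock initial condition `ξ₀`. -/
noncomputable def twoShock (N M : ℕ) : Config := fun x =>
  if (x : ℤ) ≤ -1 ∨ ((N : ℤ) + 1 ≤ x ∧ (x : ℤ) ≤ N + M) then 1
  else if (x : ℤ) = N + 2 * M + 1 then 2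
  else if (N : ℤ) + 2 * M + 2 ≤ x ∧ (x : ℤ) ≤ 2 * N + 2 * M + 1 then 1
  else ⊤

/-- The four-color two-shock initial condition `ξ̃₀`. -/
noncomputable def twoShockTilde (N M : ℕ) : Config := fun x =>
  if (x : ℤ) ≤ -1 then 1
  else if (N : ℤ) + 1 ≤ x ∧ (x : ℤ) ≤ N + M then 2
  else if 2 * (M : ℤ) + N + 1 ≤ x ∧ (x : ℤ) ≤ 2 * M + 2 * N + 1 then 3
  else ⊤

/-- In `η` there is exactly one second class particle, and its position is `g`. -/
def SecondClassAt (η : Config) (g : Site) : Prop := ∀ x : Site, η x = 2 ↔ x = g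

/-- The number of particles of color `i` that are weakly to the right of `x`. -/
noncomputable def count (i : ℕ∞) (x : ℤ) (η : Config) : ℤ :=
  ({z : Site | x ≤ (z : ℤ) ∧ η z = i}.ncard : ℤ)

end HalfSpaceTASEP

/-! The multi-color dynamics lives on the group of finitely supported signed permutations `w` of the
sites: a ring of clock `k` multiplies `w` on the right by a simple reflection whenever the two
values on the edge are in increasing order (`sortRight`), and configurations are monotone images of
`w` (`project_sortRight`). The same rule applied to positions instead of contents (`sortLeft`)
commutes with it (`sortRight_sortLeft`) and agrees with it at the identity. Hence the process
started from the identity has, at a fixed time, the same law as its inverse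
(`semigroup_sortRight_inv`), and starting from a word `l` of sorts amounts, up to inversion, to
applying the reversed word at the end (`semigroup_act_sortRight`).

Both two-shock conditions arise from monotone packed configurations by reversing two overlapping
blocks of sites (`act_packedTilde`, `act_packed`). After inversion, the number of particles of a
color on the positive half-line becomes the number of holes of the step process in an interval,
counted after sorting the sites `1, …, M + N` and then `M + 1, …, 2M + 2N + 1`. Sorting pushes the
holes to the left end of a block, so these numbers are minima of hole counts; this gives the
formulas (`counts_project_packedTilde`, `exists_neg_project_packed`).

The symmetry is an exact identity for the system driven by the first `n` clocks. To transfer it, the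
martingale problem is turned into the forward equation on local functions. Iterated generators of a
local function grow at most like `4 ^ j * j!`, so short Taylor expansions show that the one-time
marginals are limits of the finite systems (`tendsto_semigroup_of_forward`). A tail bound uniform in
`n` extends the limit to events that are not local, such as those on particle counts
(`tendsto_semigroup_indicator`). -/

namespace HalfSpaceTASEP

/-! ### Semigroups driven by finitely many clocks. -/

section Semigroup

variable {X Y : Type*}

/-- The jump operator `f ↦ ∑_{k < n} r k • f ∘ U k` of the first `n` clocks. -/
noncomputable def jumpOp (r : ℕ → ℝ) (U : ℕ → X → X) (n : ℕ) : (X → ℝ) →ₗ[ℝ] (X → ℝ) where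
  toFun f x := ∑ k ∈ Finset.range n, r k * f (U k x)
  map_add' f g := by
    ext x; simp [mul_add, Finset.sum_add_distrib]
  map_smul' c f := by
    ext x; simp only [Pi.smul_apply, smul_eq_mul, RingHom.id_apply, Finset.mul_sum]
    exact Finset.sum_congr rfl fun k _ => by ring

lemma jumpOp_apply (r : ℕ → ℝ) (U : ℕ → X → X) (n : ℕ) (f : X → ℝ) (x : X) :
    jumpOp r U n f x = ∑ k ∈ Finset.range n, r k * f (U k x) := rfl

/-- The total rate of the first `n` clocks. -/
noncomputable def totalRate (r : ℕ → ℝ) (n : ℕ) : ℝ := ∑ k ∈ Finset.range n, r k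

/-- The generator of the system driven by the first `n` clocks. -/
noncomputable def truncGen (r : ℕ → ℝ) (U : ℕ → X → X) (n : ℕ) : (X → ℝ) →ₗ[ℝ] (X → ℝ) :=
  jumpOp r U n - totalRate r n • LinearMap.id

lemma truncGen_apply (r : ℕ → ℝ) (U : ℕ → X → X) (n : ℕ) (f : X → ℝ) (x : X) :
    truncGen r U n f x = ∑ k ∈ Finset.range n, r k * (f (U k x) - f x) := by
  simp [truncGen, jumpOp_apply, totalRate, mul_sub, Finset.sum_sub_distrib, Finset.sum_mul]

/-- The semigroup of the continuous-time Markov chain driven by the first `n` clocks,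
obtained by uniformization. -/
noncomputable def semigroup (r : ℕ → ℝ) (U : ℕ → X → X) (n : ℕ) (t : ℝ) (f : X → ℝ) (x : X) : ℝ :=
  Real.exp (-(totalRate r n * t)) *
    ∑' j : ℕ, t ^ j / (j.factorial : ℝ) * ((jumpOp r U n ^ j) f) x

variable {r : ℕ → ℝ} {U : ℕ → X → X} {V : ℕ → Y → Y} {n : ℕ}

lemma totalRate_nonneg (hr : ∀ k, 0 ≤ r k) (n : ℕ) : 0 ≤ totalRate r n :=
  Finset.sum_nonneg fun k _ => hr k

lemma jumpOp_pow_succ (j : ℕ) (f : X → ℝ) (x : X) :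
    (jumpOp r U n ^ (j + 1)) f x = ∑ k ∈ Finset.range n, r k * (jumpOp r U n ^ j) f (U k x) := by
  rw [pow_succ']; rfl

lemma jumpOp_pow_mono (hr : ∀ k, 0 ≤ r k) {p : X → Prop} (hp : ∀ k x, p x → p (U k x))
    {f g : X → ℝ} (hfg : ∀ x, p x → f x ≤ g x) (j : ℕ) :
    ∀ x, p x → (jumpOp r U n ^ j) f x ≤ (jumpOp r U n ^ j) g x := by
  induction j with
  | zero => simpa using hfg
  | succ j ih =>
    intro x hx
    rw [jumpOp_pow_succ, jumpOp_pow_succ]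
    exact Finset.sum_le_sum fun k _ => mul_le_mul_of_nonneg_left (ih _ (hp k x hx)) (hr k)

lemma jumpOp_pow_const (B : ℝ) (j : ℕ) (x : X) :
    (jumpOp r U n ^ j) (fun _ => B) x = totalRate r n ^ j * B := by
  induction j generalizing x with
  | zero => simp
  | succ j ih =>
    rw [jumpOp_pow_succ, Finset.sum_congr rfl fun k _ => by rw [ih], ← Finset.sum_mul, pow_succ',
      totalRate, mul_assoc]

lemma abs_jumpOp_pow_le (hr : ∀ k, 0 ≤ r k) {f : X → ℝ} {B : ℝ} (hf : ∀ x, |f x| ≤ B) (j : ℕ)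
    (x : X) : |(jumpOp r U n ^ j) f x| ≤ totalRate r n ^ j * B := by
  have h1 := jumpOp_pow_mono (U := U) (n := n) hr (p := fun _ => True) (by simp) (f := f)
    (g := fun _ => B) (fun x _ => (abs_le.1 (hf x)).2) j x trivial
  have h2 := jumpOp_pow_mono (U := U) (n := n) hr (p := fun _ => True) (by simp)
    (f := fun _ => -B) (g := f) (fun x _ => (abs_le.1 (hf x)).1) j x trivial
  rw [jumpOp_pow_const] at h1 h2
  exact abs_le.2 ⟨by linarith, h1⟩

lemma summable_pow_div_factorial_mul {a : ℕ → ℝ} {R B : ℝ} (ha : ∀ j, |a j| ≤ R ^ j * B)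
    (t : ℝ) : Summable fun j : ℕ => t ^ j / (j.factorial : ℝ) * a j := by
  refine Summable.of_norm_bounded ((Real.summable_pow_div_factorial (|t| * R)).mul_right B) ?_
  intro j
  rw [Real.norm_eq_abs, abs_mul, abs_div, abs_pow, Nat.abs_cast, mul_pow]
  calc |t| ^ j / (j.factorial : ℝ) * |a j| ≤ |t| ^ j / (j.factorial : ℝ) * (R ^ j * B) := by
        gcongr; exact ha j
    _ = _ := by ring

lemma summable_semigroup (hr : ∀ k, 0 ≤ r k) {f : X → ℝ} {B : ℝ} (hf : ∀ x, |f x| ≤ B)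
    (t : ℝ) (x : X) :
    Summable fun j : ℕ => t ^ j / (j.factorial : ℝ) * (jumpOp r U n ^ j) f x :=
  summable_pow_div_factorial_mul (fun j => abs_jumpOp_pow_le hr hf j x) t

/-- The predicate `p` singles out states closed under all clocks, so the comparison is needed only
there. It is later taken to be the presence of exactly one second class particle. -/
lemma semigroup_mono (hr : ∀ k, 0 ≤ r k) {p : X → Prop} (hp : ∀ k x, p x → p (U k x))
    {f g : X → ℝ} {B C : ℝ} (hf : ∀ x, |f x| ≤ B) (hg : ∀ x, |g x| ≤ C)
    (hfg : ∀ x, p x → f x ≤ g x) {t : ℝ} (ht : 0 ≤ t) {x : X} (hx : p x) :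
    semigroup r U n t f x ≤ semigroup r U n t g x := by
  refine mul_le_mul_of_nonneg_left ?_ (Real.exp_pos _).le
  refine Summable.tsum_le_tsum (fun j => ?_) (summable_semigroup hr hf t x)
    (summable_semigroup hr hg t x)
  exact mul_le_mul_of_nonneg_left (jumpOp_pow_mono hr hp hfg j x hx) (by positivity)

lemma tsum_pow_div_factorial (a : ℝ) : ∑' j : ℕ, a ^ j / (j.factorial : ℝ) = Real.exp a := by
  rw [Real.exp_eq_exp_ℝ, NormedSpace.exp_eq_tsum_div]

lemma semigroup_const (B t : ℝ) (x : X) : semigroup r U n t (fun _ => B) x = B := by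
  simp only [semigroup, jumpOp_pow_const]
  have : ∀ j : ℕ, t ^ j / (j.factorial : ℝ) * (totalRate r n ^ j * B) =
      (totalRate r n * t) ^ j / (j.factorial : ℝ) * B := fun j => by rw [mul_pow]; ring
  simp only [this]
  rw [tsum_mul_right, tsum_pow_div_factorial, ← mul_assoc, ← Real.exp_add]
  simp

lemma abs_semigroup_le (hr : ∀ k, 0 ≤ r k) {f : X → ℝ} {B : ℝ} (hf : ∀ x, |f x| ≤ B)
    {t : ℝ} (ht : 0 ≤ t) (x : X) : |semigroup r U n t f x| ≤ B := by
  have hB : 0 ≤ B := (abs_nonneg _).trans (hf x)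
  have hc : ∀ y : X, |(fun _ : X => B) y| ≤ B := fun _ => (abs_of_nonneg hB).le
  have hc' : ∀ y : X, |(fun _ : X => -B) y| ≤ B := fun _ => by simp [abs_of_nonneg hB]
  have h1 := semigroup_mono (U := U) (n := n) hr (p := fun _ => True) (by simp) hf hc
    (fun x _ => (abs_le.1 (hf x)).2) ht (x := x) trivial
  have h2 := semigroup_mono (U := U) (n := n) hr (p := fun _ => True) (by simp) hc' hf
    (fun x _ => (abs_le.1 (hf x)).1) ht (x := x) trivial
  rw [semigroup_const] at h1 h2
  exact abs_le.2 ⟨h2, h1⟩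

lemma semigroup_sub (hr : ∀ k, 0 ≤ r k) {f g : X → ℝ} {B C : ℝ} (hf : ∀ x, |f x| ≤ B)
    (hg : ∀ x, |g x| ≤ C) (t : ℝ) (x : X) :
    semigroup r U n t (f - g) x = semigroup r U n t f x - semigroup r U n t g x := by
  simp only [semigroup]
  rw [← mul_sub, ← (summable_semigroup hr hf t x).tsum_sub (summable_semigroup hr hg t x)]
  congr 2; ext j
  rw [map_sub, Pi.sub_apply, mul_sub]

lemma semigroup_congr (hr : ∀ k, 0 ≤ r k) {p : X → Prop} (hp : ∀ k x, p x → p (U k x))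
    {f g : X → ℝ} (hfg : ∀ x, p x → f x = g x) (t : ℝ) {x : X} (hx : p x) :
    semigroup r U n t f x = semigroup r U n t g x := by
  simp only [semigroup]
  congr 2; ext j
  rw [le_antisymm (jumpOp_pow_mono hr hp (fun x hx => (hfg x hx).le) j x hx)
    (jumpOp_pow_mono hr hp (fun x hx => (hfg x hx).ge) j x hx)]

lemma abs_semigroup_sub_le (hr : ∀ k, 0 ≤ r k) {p : X → Prop} (hp : ∀ k x, p x → p (U k x))
    {f g e : X → ℝ} {B C D : ℝ} (hf : ∀ x, |f x| ≤ B) (hg : ∀ x, |g x| ≤ C) (he : ∀ x, |e x| ≤ D)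
    (hfg : ∀ x, p x → |f x - g x| ≤ e x) {t : ℝ} (ht : 0 ≤ t) {x : X} (hx : p x) :
    |semigroup r U n t f x - semigroup r U n t g x| ≤ semigroup r U n t e x := by
  have h1 : ∀ y, |(f - g) y| ≤ B + C := fun y =>
    (abs_sub _ _).trans (add_le_add (hf y) (hg y))
  have h2 : ∀ y, |(g - f) y| ≤ C + B := fun y =>
    (abs_sub _ _).trans (add_le_add (hg y) (hf y))
  have h3 := semigroup_mono (n := n) hr hp h1 he (fun x hx => (le_abs_self _).trans (hfg x hx)) ht hx
  have h4 := semigroup_mono (n := n) hr hp h2 he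
    (fun x hx => (le_abs_self _).trans (abs_sub_comm (g x) (f x) ▸ hfg x hx)) ht hx
  rw [semigroup_sub hr hf hg] at h3
  rw [semigroup_sub hr hg hf] at h4
  exact abs_le.2 ⟨by linarith, h3⟩

/-- Lumping: a map that intertwines the clocks carries one chain to the other. It serves for
inversion, for left sorting and for the projection to colors. -/
lemma jumpOp_pow_comp {φ : X → Y} (h : ∀ k x, φ (U k x) = V k (φ x)) (f : Y → ℝ) (j : ℕ) (x : X) :
    (jumpOp r V n ^ j) f (φ x) = (jumpOp r U n ^ j) (f ∘ φ) x := by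
  induction j generalizing x with
  | zero => rfl
  | succ j ih =>
    rw [jumpOp_pow_succ, jumpOp_pow_succ]
    exact Finset.sum_congr rfl fun k _ => by rw [← h, ih]

lemma semigroup_comp {φ : X → Y} (h : ∀ k x, φ (U k x) = V k (φ x)) (f : Y → ℝ) (t : ℝ) (x : X) :
    semigroup r V n t f (φ x) = semigroup r U n t (f ∘ φ) x := by
  simp only [semigroup, jumpOp_pow_comp h]

/-- A Lyapunov bound: with total rate `R`, iterating the one-jump estimate gives `(R + c) ^ j * f`,
and the factor `exp (-(R * t))` of the uniformization leaves `exp (c * t)`. -/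
lemma semigroup_le_exp_mul (hr : ∀ k, 0 ≤ r k) {f : X → ℝ} {B c : ℝ} (hf : ∀ x, |f x| ≤ B)
    (hc : 0 ≤ c) (h : ∀ x, jumpOp r U n f x ≤ (totalRate r n + c) * f x) {t : ℝ} (ht : 0 ≤ t)
    (x : X) : semigroup r U n t f x ≤ Real.exp (c * t) * f x := by
  have hR := totalRate_nonneg hr n
  have key : ∀ (j : ℕ) (x : X), (jumpOp r U n ^ j) f x ≤ (totalRate r n + c) ^ j * f x := by
    intro j
    induction j with
    | zero => simp
    | succ j ih =>
      intro x
      rw [jumpOp_pow_succ]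
      calc _ ≤ ∑ k ∈ Finset.range n, r k * ((totalRate r n + c) ^ j * f (U k x)) :=
            Finset.sum_le_sum fun k _ => mul_le_mul_of_nonneg_left (ih _) (hr k)
        _ = (totalRate r n + c) ^ j * jumpOp r U n f x := by
            rw [jumpOp_apply, Finset.mul_sum]; exact Finset.sum_congr rfl fun k _ => by ring
        _ ≤ (totalRate r n + c) ^ j * ((totalRate r n + c) * f x) := by
            gcongr; exact h x
        _ = _ := by ring
  have h1 : ∀ j : ℕ, t ^ j / (j.factorial : ℝ) * ((totalRate r n + c) ^ j * f x) =
      (t * (totalRate r n + c)) ^ j / (j.factorial : ℝ) * f x := fun j => by rw [mul_pow]; ring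
  calc semigroup r U n t f x
      ≤ Real.exp (-(totalRate r n * t)) *
        ∑' j : ℕ, t ^ j / (j.factorial : ℝ) * ((totalRate r n + c) ^ j * f x) := by
        refine mul_le_mul_of_nonneg_left ?_ (Real.exp_pos _).le
        refine Summable.tsum_le_tsum (fun j => ?_) (summable_semigroup hr hf t x) ?_
        · exact mul_le_mul_of_nonneg_left (key j x) (by positivity)
        · simp only [h1]
          exact (Real.summable_pow_div_factorial _).mul_right _
    _ = Real.exp (c * t) * f x := by
        simp only [h1]
        rw [tsum_mul_right, tsum_pow_div_factorial, ← mul_assoc, ← Real.exp_add]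
        ring_nf

lemma hasDerivAt_tsum_pow_div_factorial {a : ℕ → ℝ} {R B : ℝ} (ha : ∀ j, |a j| ≤ R ^ j * B)
    (t : ℝ) :
    HasDerivAt (fun s : ℝ => ∑' j : ℕ, s ^ j / (j.factorial : ℝ) * a j)
      (∑' j : ℕ, t ^ j / (j.factorial : ℝ) * a (j + 1)) t := by
  -- A ball that contains `t` and on which the derivatives of the terms are dominated by one
  -- summable sequence.
  set T : ℝ := |t| + 1
  have hT : 0 ≤ T := by positivity
  have hs : Summable fun j : ℕ => T ^ j / (j.factorial : ℝ) * (R ^ (j + 1) * B) := by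
    have := (Real.summable_pow_div_factorial (T * R)).mul_right (R * B)
    refine this.congr fun j => ?_
    rw [mul_pow]; ring
  let g' : ℕ → ℝ → ℝ := fun j s => match j with
    | 0 => 0
    | j + 1 => s ^ j / (j.factorial : ℝ) * a (j + 1)
  have hs' : Summable fun j : ℕ => (match j with
    | 0 => 0
    | j + 1 => T ^ j / (j.factorial : ℝ) * (R ^ (j + 1) * B) : ℝ) :=
    (summable_nat_add_iff 1).1 hs
  have hd : ∀ (j : ℕ), ∀ y ∈ Metric.ball (0 : ℝ) T,
      HasDerivAt (fun s : ℝ => s ^ j / (j.factorial : ℝ) * a j) (g' j y) y := by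
    intro j y _
    cases j with
    | zero => simpa [g'] using hasDerivAt_const y (a 0)
    | succ j =>
      refine (((hasDerivAt_pow (j + 1) y).div_const ((j + 1).factorial : ℝ)).mul_const
        (a (j + 1))).congr_deriv ?_
      change _ = y ^ j / (j.factorial : ℝ) * a (j + 1)
      simp only [Nat.factorial_succ, Nat.add_sub_cancel]
      push_cast
      field_simp
  have hb : ∀ (j : ℕ), ∀ y ∈ Metric.ball (0 : ℝ) T, ‖g' j y‖ ≤ (match j with
    | 0 => 0
    | j + 1 => T ^ j / (j.factorial : ℝ) * (R ^ (j + 1) * B) : ℝ) := by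
    intro j y hy
    cases j with
    | zero => simp [g']
    | succ j =>
      have hy' : |y| ≤ T := by simpa using (Metric.mem_ball.1 hy).le
      simp only [g', Real.norm_eq_abs, abs_mul, abs_div, abs_pow, Nat.abs_cast]
      gcongr
      exact ha _
  have ht : t ∈ Metric.ball (0 : ℝ) T := by simp [T]
  have := hasDerivAt_tsum_of_isPreconnected hs' Metric.isOpen_ball
    (convex_ball (0 : ℝ) T).isPreconnected hd hb ht (summable_pow_div_factorial_mul ha t) ht
  have hsum : Summable fun j => g' j t := hs'.of_norm_bounded (fun j => hb j t ht)
  rw [hsum.tsum_eq_zero_add] at this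
  simpa [g'] using this

lemma hasDerivAt_semigroup (hr : ∀ k, 0 ≤ r k) {f : X → ℝ} {B : ℝ} (hf : ∀ x, |f x| ≤ B)
    (t : ℝ) (x : X) :
    HasDerivAt (fun s => semigroup r U n s f x) (semigroup r U n t (truncGen r U n f) x) t := by
  have h1 := hasDerivAt_tsum_pow_div_factorial (fun j => abs_jumpOp_pow_le (U := U) (n := n)
    hr hf j x) t
  have h2 : HasDerivAt (fun s => Real.exp (-(totalRate r n * s)))
      (Real.exp (-(totalRate r n * t)) * (-(totalRate r n * 1))) t :=
    ((hasDerivAt_id t).const_mul (totalRate r n)).neg.exp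
  have h3 := h2.mul h1
  refine h3.congr_deriv ?_
  -- The jump operator minus the total rate reproduces the two terms of the product rule.
  have h4 : ∀ j : ℕ, (jumpOp r U n ^ j) (truncGen r U n f) x =
      (jumpOp r U n ^ (j + 1)) f x - totalRate r n * (jumpOp r U n ^ j) f x := by
    intro j
    rw [truncGen, LinearMap.sub_apply, map_sub, pow_succ]
    simp
  have hs1 : Summable fun j : ℕ => t ^ j / (j.factorial : ℝ) * (jumpOp r U n ^ (j + 1)) f x := by
    refine summable_pow_div_factorial_mul (R := totalRate r n) (B := totalRate r n * B)
      (fun j => ?_) t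
    calc _ ≤ _ := abs_jumpOp_pow_le hr hf (j + 1) x
      _ = _ := by ring
  have hs2 := (summable_semigroup (U := U) (n := n) hr hf t x).mul_left (totalRate r n)
  simp only [semigroup, h4]
  have h5 : ∀ j : ℕ, t ^ j / (j.factorial : ℝ) *
      ((jumpOp r U n ^ (j + 1)) f x - totalRate r n * (jumpOp r U n ^ j) f x) =
      t ^ j / (j.factorial : ℝ) * (jumpOp r U n ^ (j + 1)) f x -
      totalRate r n * (t ^ j / (j.factorial : ℝ) * (jumpOp r U n ^ j) f x) := fun j => by ring
  simp only [h5]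
  rw [hs1.tsum_sub hs2, tsum_mul_left]
  ring

lemma semigroup_zero (f : X → ℝ) (x : X) : semigroup r U n 0 f x = f x := by
  rw [semigroup, tsum_eq_single 0 (fun j hj => by simp [hj])]
  simp

end Semigroup

/-! ### Taylor expansion with one-sided derivatives. -/

/-- Taylor's formula with remainder for a hierarchy of functions, each one being the derivative
of its predecessor. -/
lemma abs_sub_taylor_le {h : ℕ → ℝ → ℝ} {B : ℝ} {J : ℕ}
    (hd : ∀ j < J, ∀ s, 0 ≤ s → HasDerivWithinAt (h j) (h (j + 1) s) (Set.Ici s) s)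
    (hc : ∀ j < J, ContinuousOn (h j) (Set.Ici 0))
    (hB : ∀ s, 0 ≤ s → |h J s| ≤ B) {s τ : ℝ} (hs : 0 ≤ s) (hτ : 0 ≤ τ) :
    |h 0 (s + τ) - ∑ j ∈ Finset.range J, τ ^ j / (j.factorial : ℝ) * h j s| ≤
      B * (τ ^ J / (J.factorial : ℝ)) := by
  induction J generalizing h τ with
  | zero => simpa using hB (s + τ) (by positivity)
  | succ J ih =>
    have ih' : ∀ u, 0 ≤ u → |h 1 (s + u) -
        ∑ j ∈ Finset.range J, u ^ j / (j.factorial : ℝ) * h (j + 1) s| ≤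
        B * (u ^ J / (J.factorial : ℝ)) := fun u hu =>
      ih (h := fun j => h (j + 1)) (fun j hj => hd (j + 1) (by omega))
        (fun j hj => hc (j + 1) (by omega)) hB hu
    let g : ℝ → ℝ := fun u => h 0 (s + u) -
      ∑ j ∈ Finset.range (J + 1), u ^ j / (j.factorial : ℝ) * h j s
    let g' : ℝ → ℝ := fun u => h 1 (s + u) -
      ∑ j ∈ Finset.range J, u ^ j / (j.factorial : ℝ) * h (j + 1) s
    have hpoly : ∀ u : ℝ, HasDerivAt
        (fun u : ℝ => ∑ j ∈ Finset.range (J + 1), u ^ j / (j.factorial : ℝ) * h j s)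
        (∑ j ∈ Finset.range J, u ^ j / (j.factorial : ℝ) * h (j + 1) s) u := by
      intro u
      have : ∀ u : ℝ, ∑ j ∈ Finset.range (J + 1), u ^ j / (j.factorial : ℝ) * h j s =
          ∑ j ∈ Finset.range J, u ^ (j + 1) / ((j + 1).factorial : ℝ) * h (j + 1) s + h 0 s := by
        intro u; rw [Finset.sum_range_succ']; simp
      simp only [this]
      refine HasDerivAt.add_const _ (HasDerivAt.fun_sum fun j _ => ?_)
      refine (((hasDerivAt_pow (j + 1) u).div_const ((j + 1).factorial : ℝ)).mul_const
        (h (j + 1) s)).congr_deriv ?_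
      simp only [Nat.factorial_succ, Nat.add_sub_cancel]
      push_cast
      field_simp
    have hg : ∀ u ∈ Set.Ico 0 τ, HasDerivWithinAt g (g' u) (Set.Ici u) u := by
      intro u hu
      refine HasDerivWithinAt.sub ?_ (hpoly u).hasDerivWithinAt
      have h1 := hd 0 (by omega) (s + u) (add_nonneg hs hu.1)
      have h2 : HasDerivWithinAt (fun u => s + u) 1 (Set.Ici u) u :=
        ((hasDerivAt_id u).const_add s).hasDerivWithinAt
      have h3 := HasDerivWithinAt.scomp u h1 h2 (fun v hv => by
        simpa using hv)
      simpa [Function.comp_def] using h3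
    have hgc : ContinuousOn g (Set.Icc 0 τ) := by
      refine ContinuousOn.sub ?_ (fun u _ => (hpoly u).continuousAt.continuousWithinAt)
      refine (hc 0 (by omega)).comp (by fun_prop) fun u hu => ?_
      exact add_nonneg hs hu.1
    have hb : ∀ u : ℝ, HasDerivAt (fun u : ℝ => B * (u ^ (J + 1) / ((J + 1).factorial : ℝ)))
        (B * (u ^ J / (J.factorial : ℝ))) u := by
      intro u
      refine (((hasDerivAt_pow (J + 1) u).div_const ((J + 1).factorial : ℝ)).const_mul
        B).congr_deriv ?_
      simp only [Nat.factorial_succ, Nat.add_sub_cancel]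
      push_cast
      field_simp
    have h0 : ‖g 0‖ ≤ B * (0 ^ (J + 1) / ((J + 1).factorial : ℝ)) := by
      simp [g, Finset.sum_range_succ']
    -- Mean value inequality for right derivatives: by induction the derivative of `g` is bounded by
    -- that of the claimed remainder.
    exact image_norm_le_of_norm_deriv_right_le_deriv_boundary hgc hg h0 hb
      (fun u hu => ih' u hu.1) ⟨hτ, le_rfl⟩


/-! ### Sites, updates and locality of the generator. -/

lemma coe_pos (k : ℕ) : ((pos k : Site) : ℤ) = k + 1 := rfl

lemma coe_neg (k : ℕ) : ((neg k : Site) : ℤ) = -((k : ℤ) + 1) := rfl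

lemma site_eq_iff {x y : Site} : x = y ↔ (x : ℤ) = y := Subtype.ext_iff

lemma site_cases (x : Site) : (∃ k, x = pos k) ∨ ∃ k, x = neg k := by
  obtain ⟨x, hx⟩ := x
  rcases lt_or_gt_of_ne hx with h | h
  · exact .inr ⟨(-x - 1).toNat, site_eq_iff.2 (by rw [coe_neg]; dsimp only; omega)⟩
  · exact .inl ⟨(x - 1).toNat, site_eq_iff.2 (by rw [coe_pos]; dsimp only; omega)⟩

/-- Sorting a pair of sites puts the weaker particle to the left. -/
lemma swapIfLT_apply {a b : Site} (hab : a ≠ b) (η : Config) (x : Site) :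
    swapIfLT a b η x =
      if x = a then max (η a) (η b) else if x = b then min (η a) (η b) else η x := by
  unfold swapIfLT
  split_ifs with h h1 h2 h1 h2
  · subst h1; simp [h.le]
  · subst h2; simp [h.le]
  · simp [Equiv.swap_apply_of_ne_of_ne h1 h2]
  · subst h1; simp [not_lt.1 h]
  · subst h2; simp [not_lt.1 h]
  · rfl

lemma update_zero_apply (η : Config) (x : Site) :
    update 0 η x = if x = neg 0 then max (η (neg 0)) (η (pos 0)) else
      if x = pos 0 then min (η (neg 0)) (η (pos 0)) else η x :=
  swapIfLT_apply (by simp [site_eq_iff, coe_pos, coe_neg]) η x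

lemma update_succ_apply (k : ℕ) (η : Config) (x : Site) :
    update (k + 1) η x =
      if x = pos k then max (η (pos k)) (η (pos (k + 1))) else
      if x = pos (k + 1) then min (η (pos k)) (η (pos (k + 1))) else
      if x = neg (k + 1) then max (η (neg (k + 1))) (η (neg k)) else
      if x = neg k then min (η (neg (k + 1))) (η (neg k)) else η x := by
  have h1 : neg (k + 1) ≠ neg k := by simp [site_eq_iff, coe_neg]
  have h2 : pos k ≠ pos (k + 1) := by simp [site_eq_iff, coe_pos]
  have e1 : ∀ i j, neg i ≠ pos j := fun i j => by
    rw [Ne, site_eq_iff, coe_neg, coe_pos]; omega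
  change swapIfLT (neg (k + 1)) (neg k) (swapIfLT (pos k) (pos (k + 1)) η) x = _
  rw [swapIfLT_apply h1]
  simp only [swapIfLT_apply h2, e1, if_false]
  split_ifs <;> first | rfl | (exfalso; subst_vars; simp_all [site_eq_iff, coe_pos, coe_neg]; try omega)

/-- Away from its own sites a clock does nothing. -/
lemma update_apply_of_ne {k : ℕ} (η : Config) {x : Site} (h1 : |(x : ℤ)| ≠ k)
    (h2 : |(x : ℤ)| ≠ k + 1) : update k η x = η x := by
  cases k with
  | zero =>
    rw [update_zero_apply, if_neg, if_neg] <;>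
    · rintro rfl
      simp [coe_pos, coe_neg] at h2
  | succ k =>
    have e1 : |((pos k : Site) : ℤ)| = k + 1 := by rw [coe_pos, abs_of_nonneg (by omega)]
    have e2 : |((neg k : Site) : ℤ)| = k + 1 := by
      rw [coe_neg, abs_neg, abs_of_nonneg (by omega)]
    have e3 : |((pos (k + 1) : Site) : ℤ)| = k + 2 := by
      rw [coe_pos, abs_of_nonneg] <;> push_cast <;> omega
    have e4 : |((neg (k + 1) : Site) : ℤ)| = k + 2 := by
      rw [coe_neg, abs_neg, abs_of_nonneg] <;> push_cast <;> omega
    rw [update_succ_apply, if_neg, if_neg, if_neg, if_neg] <;>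
    · rintro rfl
      push_cast at *
      omega

/-- The content of a site after a ring of the clock `k` comes from a site with the same or, if the
site belongs to the clock, with a neighboring absolute value. -/
lemma update_apply_cases (k : ℕ) (η : Config) (x : Site) :
    update k η x = η x ∨ ∃ y : Site, update k η x = η y ∧
      ((0 < (x : ℤ) ↔ 0 < (y : ℤ)) ∨ k = 0) ∧
      ((|(x : ℤ)| = k ∨ |(x : ℤ)| = k + 1) ∧ (|(y : ℤ)| = k ∨ |(y : ℤ)| = k + 1)) := by
  have ab : ∀ z : ℤ, ∀ c : ℤ, 0 ≤ c → (z = c ∨ z = -c) → |z| = c := by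
    rintro z c hc (rfl | rfl)
    · exact abs_of_nonneg hc
    · rw [abs_neg, abs_of_nonneg hc]
  cases k with
  | zero =>
    rw [update_zero_apply]
    split_ifs with h1 h2
    · subst h1
      rcases max_choice (η (neg 0)) (η (pos 0)) with h | h <;> rw [h]
      · exact .inl rfl
      · exact .inr ⟨_, rfl, .inr rfl, .inr (ab _ _ (by simp) (by simp [coe_neg])),
          .inr (ab _ _ (by simp) (by simp [coe_pos]))⟩
    · subst h2
      rcases min_choice (η (neg 0)) (η (pos 0)) with h | h <;> rw [h]
      · exact .inr ⟨_, rfl, .inr rfl, .inr (ab _ _ (by simp) (by simp [coe_pos])),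
          .inr (ab _ _ (by simp) (by simp [coe_neg]))⟩
      · exact .inl rfl
    · exact .inl rfl
  | succ k =>
    have p1 : |((pos k : Site) : ℤ)| = ((k + 1 : ℕ) : ℤ) :=
      ab _ _ (by positivity) (by rw [coe_pos]; push_cast; simp)
    have p2 : |((pos (k + 1) : Site) : ℤ)| = ((k + 1 : ℕ) : ℤ) + 1 :=
      ab _ _ (by positivity) (by rw [coe_pos]; simp)
    have p3 : |((neg k : Site) : ℤ)| = ((k + 1 : ℕ) : ℤ) :=
      ab _ _ (by positivity) (by rw [coe_neg]; push_cast; simp)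
    have p4 : |((neg (k + 1) : Site) : ℤ)| = ((k + 1 : ℕ) : ℤ) + 1 :=
      ab _ _ (by positivity) (by rw [coe_neg]; simp)
    have q1 : 0 < ((pos k : Site) : ℤ) ↔ 0 < ((pos (k + 1) : Site) : ℤ) := by
      rw [coe_pos, coe_pos]; push_cast; omega
    have q2 : 0 < ((neg k : Site) : ℤ) ↔ 0 < ((neg (k + 1) : Site) : ℤ) := by
      rw [coe_neg, coe_neg]; push_cast; omega
    rw [update_succ_apply]
    split_ifs with h1 h2 h3 h4
    · subst h1
      rcases max_choice (η (pos k)) (η (pos (k + 1))) with h | h <;> rw [h]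
      · exact .inl rfl
      · exact .inr ⟨_, rfl, .inl q1, .inl p1, .inr p2⟩
    · subst h2
      rcases min_choice (η (pos k)) (η (pos (k + 1))) with h | h <;> rw [h]
      · exact .inr ⟨_, rfl, .inl q1.symm, .inr p2, .inl p1⟩
      · exact .inl rfl
    · subst h3
      rcases max_choice (η (neg (k + 1))) (η (neg k)) with h | h <;> rw [h]
      · exact .inl rfl
      · exact .inr ⟨_, rfl, .inl q2.symm, .inr p4, .inl p3⟩
    · subst h4
      rcases min_choice (η (neg (k + 1))) (η (neg k)) with h | h <;> rw [h]
      · exact .inr ⟨_, rfl, .inl q2, .inl p3, .inr p4⟩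
      · exact .inl rfl
    · exact .inl rfl

/-- `f` depends only on the sites in `[-m, m]`. -/
def LocalIn (m : ℕ) (f : Config → ℝ) : Prop := DependsOn f {x : Site | |(x : ℤ)| ≤ m}

lemma LocalIn.isLocal {m : ℕ} {f : Config → ℝ} (hf : LocalIn m f) : IsLocal f := ⟨m, hf⟩

/-- A single ring moves contents by one step only; this is why each application of the generator
widens the window by one. -/
lemma update_congr {m : ℕ} {η η' : Config} (h : ∀ x : Site, |(x : ℤ)| ≤ (m + 1 : ℕ) → η x = η' x)
    (k : ℕ) (x : Site) (hx : |(x : ℤ)| ≤ m) : update k η x = update k η' x := by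
  push_cast at h
  by_cases h1 : |(x : ℤ)| ≠ k ∧ |(x : ℤ)| ≠ k + 1
  · rw [update_apply_of_ne _ h1.1 h1.2, update_apply_of_ne _ h1.1 h1.2, h x (by omega)]
  · have hk : k ≤ m := by omega
    cases k with
    | zero =>
      rw [update_zero_apply, update_zero_apply, h x (by omega), h (neg 0) (by simp [coe_neg]),
        h (pos 0) (by simp [coe_pos])]
    | succ k =>
      rw [update_succ_apply, update_succ_apply, h x (by omega),
        h (pos k) (by rw [coe_pos, abs_le]; constructor <;> omega),
        h (neg k) (by rw [coe_neg, abs_le]; constructor <;> omega),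
        h (pos (k + 1)) (by rw [coe_pos, abs_le]; constructor <;> push_cast <;> omega),
        h (neg (k + 1)) (by rw [coe_neg, abs_le]; constructor <;> push_cast <;> omega)]

lemma LocalIn.apply_update {m : ℕ} {f : Config → ℝ} (hf : LocalIn m f) {k : ℕ} (hk : m < k)
    (η : Config) : f (update k η) = f η :=
  hf fun x hx => update_apply_of_ne η (by simp at hx; omega) (by simp at hx; omega)

lemma rate_nonneg {α : ℝ} (hα : 0 ≤ α) (k : ℕ) : 0 ≤ rate α k := by
  cases k <;> simp [rate, hα]

lemma totalRate_rate_succ (α : ℝ) (n : ℕ) : totalRate (rate α) (n + 1) = α + n := by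
  rw [totalRate, Finset.sum_range_succ']
  simp [rate, add_comm]

/-- On functions that depend on `[-m, m]` only the first `m + 1` clocks matter. -/
lemma LocalIn.generator_eq {m n : ℕ} {α : ℝ} {f : Config → ℝ} (hf : LocalIn m f) (hn : m < n) :
    generator α f = truncGen (rate α) update n f := by
  ext η
  rw [truncGen_apply, generator]
  refine tsum_eq_sum fun k hk => ?_
  rw [hf.apply_update (by simp at hk; omega), sub_self, mul_zero]

lemma LocalIn.generator {m : ℕ} {α : ℝ} {f : Config → ℝ} (hf : LocalIn m f) :
    LocalIn (m + 1) (generator α f) := by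
  rw [hf.generator_eq (Nat.lt_succ_self m)]
  intro η η' h
  rw [truncGen_apply, truncGen_apply]
  refine Finset.sum_congr rfl fun k _ => ?_
  rw [hf fun x hx => update_congr (fun x hx => h x hx) k x hx,
    hf fun x (hx : |(x : ℤ)| ≤ m) => h x (show |(x : ℤ)| ≤ (m + 1 : ℕ) by push_cast; omega)]

lemma LocalIn.abs_generator_le {m : ℕ} {α B : ℝ} (hα : 0 ≤ α) {f : Config → ℝ} (hf : LocalIn m f)
    (hB : ∀ η, |f η| ≤ B) (η : Config) : |HalfSpaceTASEP.generator α f η| ≤ 2 * (α + m) * B := by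
  rw [hf.generator_eq (Nat.lt_succ_self m), truncGen_apply]
  calc _ ≤ ∑ k ∈ Finset.range (m + 1), |rate α k * (f (update k η) - f η)| :=
        Finset.abs_sum_le_sum_abs _ _
    _ ≤ ∑ k ∈ Finset.range (m + 1), rate α k * (2 * B) := by
        refine Finset.sum_le_sum fun k _ => ?_
        rw [abs_mul, abs_of_nonneg (rate_nonneg hα k)]
        refine mul_le_mul_of_nonneg_left ?_ (rate_nonneg hα k)
        refine (abs_sub _ _).trans ?_
        linarith [hB (update k η), hB η]
    _ = totalRate (rate α) (m + 1) * (2 * B) := by rw [← Finset.sum_mul]; rfl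
    _ = _ := by rw [totalRate_rate_succ]; ring

lemma LocalIn.generator_iterate {m : ℕ} {α : ℝ} {f : Config → ℝ} (hf : LocalIn m f) (j : ℕ) :
    LocalIn (m + j) ((HalfSpaceTASEP.generator α)^[j] f) := by
  induction j with
  | zero => exact hf
  | succ j ih => rw [Function.iterate_succ_apply']; exact ih.generator

/-- The iterated generators of a local function grow at most factorially, with a geometric rate
that does not depend on the function. -/
lemma LocalIn.abs_generator_iterate_le {m c : ℕ} {α B : ℝ} (hα : 0 ≤ α) {f : Config → ℝ}
    (hf : LocalIn m f) (hB : ∀ η, |f η| ≤ B) (hc : α + m ≤ c) (j : ℕ) (η : Config) :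
    |(HalfSpaceTASEP.generator α)^[j] f η| ≤ 2 ^ c * 4 ^ j * j.factorial * B := by
  have hB0 : 0 ≤ B := (abs_nonneg _).trans (hB η)
  have key : ∀ (j : ℕ) (η : Config),
      |(HalfSpaceTASEP.generator α)^[j] f η| ≤ 2 ^ j * (c.ascFactorial j) * B := by
    intro j
    induction j with
    | zero => simpa using hB
    | succ j ih =>
      intro η
      rw [Function.iterate_succ_apply']
      refine ((hf.generator_iterate j).abs_generator_le hα ih η).trans ?_
      rw [Nat.ascFactorial_succ]
      push_cast
      -- The integer `c` dominates `α + m`, so that the product of the successive total rates is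
      -- bounded by an ascending factorial.
      have : 2 * (α + (m + j)) * (2 ^ j * (c.ascFactorial j : ℝ) * B) ≤
          2 * (c + j) * (2 ^ j * (c.ascFactorial j : ℝ) * B) := by
        have h : α + (m + j) ≤ c + j := by linarith
        have h' : 2 * (α + (m + j)) ≤ 2 * (c + (j : ℝ)) := by linarith
        exact mul_le_mul_of_nonneg_right h' (by positivity)
      exact this.trans (le_of_eq (by ring))
  refine (key j η).trans ?_
  -- An ascending factorial is `j!` times a binomial coefficient, which is at most a power of two.
  have h1 : c.ascFactorial j ≤ j.factorial * 2 ^ (c + j) := by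
    rw [Nat.ascFactorial_eq_factorial_mul_choose']
    exact Nat.mul_le_mul_left _ ((Nat.choose_le_two_pow _ _).trans
      (Nat.pow_le_pow_right two_pos (Nat.sub_le _ _)))
  have h2 : (c.ascFactorial j : ℝ) ≤ j.factorial * 2 ^ (c + j) := by exact_mod_cast h1
  calc (2 : ℝ) ^ j * (c.ascFactorial j) * B ≤ 2 ^ j * (j.factorial * 2 ^ (c + j)) * B := by gcongr
    _ = 2 ^ c * (2 * 2) ^ j * j.factorial * B := by rw [mul_pow, pow_add]; ring
    _ = _ := by norm_num


/-! ### The forward equation determines the marginals. -/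

section Convergence

variable {α : ℝ} {η₀ : Config}

/-- If the finite systems converge at time `s`, then also at slightly later times. -/
lemma tendsto_semigroup_step (hα : 0 ≤ α) {e : (Config → ℝ) → ℝ → ℝ}
    (hb : ∀ {f : Config → ℝ} {B : ℝ}, IsLocal f → (∀ η, |f η| ≤ B) → ∀ s, |e f s| ≤ B)
    (hc : ∀ {f : Config → ℝ} {B : ℝ}, IsLocal f → (∀ η, |f η| ≤ B) →
      ContinuousOn (e f) (Set.Ici 0))
    (hd : ∀ {f : Config → ℝ} {B : ℝ}, IsLocal f → (∀ η, |f η| ≤ B) →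
      ∀ s, 0 ≤ s → HasDerivWithinAt (e f) (e (generator α f) s) (Set.Ici s) s)
    {s τ : ℝ} (hs : 0 ≤ s) (hτ : 0 ≤ τ) (hτ' : τ ≤ 1 / 8)
    (h : ∀ {f : Config → ℝ} {B : ℝ}, IsLocal f → (∀ η, |f η| ≤ B) →
      Tendsto (fun n => semigroup (rate α) update n s f η₀) atTop (𝓝 (e f s)))
    {f : Config → ℝ} {B : ℝ} (hf : IsLocal f) (hB : ∀ η, |f η| ≤ B) :
    Tendsto (fun n => semigroup (rate α) update n (s + τ) f η₀) atTop (𝓝 (e f (s + τ))) := by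
  obtain ⟨m, hf⟩ := hf
  replace hf : LocalIn m f := hf
  have hr := rate_nonneg hα
  have hB0 : 0 ≤ B := (abs_nonneg _).trans (hB η₀)
  obtain ⟨c, hmc⟩ := exists_nat_ge (α + m)
  have hgb := fun j => hf.abs_generator_iterate_le hα hB hmc j
  have hgl := fun j => (hf.generator_iterate (α := α) j).isLocal
  -- The factorials cancel, and `τ ≤ 1 / 8` makes `4 * τ ≤ 1 / 2`. The ratio depends on neither `f`
  -- nor `s`, so the same step length can be used again and again.
  have hrem : ∀ J : ℕ, 2 ^ c * 4 ^ J * J.factorial * B * (τ ^ J / (J.factorial : ℝ)) ≤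
      2 ^ c * B * (1 / 2) ^ J := by
    intro J
    have : (4 * τ) ^ J ≤ (1 / 2) ^ J := by gcongr; linarith
    calc _ = 2 ^ c * B * (4 * τ) ^ J := by
          have : (J.factorial : ℝ) ≠ 0 := by positivity
          rw [mul_pow]; field_simp
      _ ≤ _ := by gcongr
  have he : ∀ J : ℕ, |e f (s + τ) - ∑ j ∈ Finset.range J, τ ^ j / (j.factorial : ℝ) *
      e ((generator α)^[j] f) s| ≤ 2 ^ c * B * (1 / 2) ^ J := by
    intro J
    refine (abs_sub_taylor_le (h := fun j => e ((generator α)^[j] f)) (J := J) ?_ ?_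
      (fun s _ => hb (hgl J) (hgb J) s) hs hτ).trans (hrem J)
    · intro j _ u hu
      simp only [Function.iterate_succ_apply']
      exact hd (hgl j) (hgb j) u hu
    · exact fun j _ => hc (hgl j) (hgb j)
  -- Once `m + J ≤ n`, the first `J` applications of the generator do not notice the missing clocks,
  -- so the remainder is bounded uniformly in `n`.
  have hS : ∀ J n : ℕ, m + J ≤ n → |semigroup (rate α) update n (s + τ) f η₀ -
      ∑ j ∈ Finset.range J, τ ^ j / (j.factorial : ℝ) *
      semigroup (rate α) update n s ((generator α)^[j] f) η₀| ≤ 2 ^ c * B * (1 / 2) ^ J := by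
    intro J n hn
    refine (abs_sub_taylor_le
      (h := fun j s => semigroup (rate α) update n s ((generator α)^[j] f) η₀) (J := J) ?_ ?_
      (fun s hs => abs_semigroup_le hr (hgb J) hs η₀) hs hτ).trans (hrem J)
    · intro j hj u _
      have := (hasDerivAt_semigroup (U := update) (n := n) hr (hgb j) u η₀).hasDerivWithinAt
        (s := Set.Ici u)
      rw [← (hf.generator_iterate j).generator_eq (n := n) (by omega)] at this
      simpa only [Function.iterate_succ_apply'] using this
    · exact fun j _ u _ =>
        (hasDerivAt_semigroup (U := update) (n := n) hr (hgb j) u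
          η₀).continuousAt.continuousWithinAt
  rw [Metric.tendsto_atTop]
  intro ε hε
  obtain ⟨J, hJ⟩ : ∃ J : ℕ, 2 ^ c * B * (1 / 2) ^ J < ε / 3 := by
    have : Tendsto (fun J : ℕ => 2 ^ c * B * (1 / 2 : ℝ) ^ J) atTop (𝓝 (2 ^ c * B * 0)) :=
      (tendsto_pow_atTop_nhds_zero_of_lt_one (by norm_num) (by norm_num)).const_mul _
    rw [mul_zero] at this
    exact (this.eventually_lt_const (by positivity)).exists
  have hsum : Tendsto (fun n => ∑ j ∈ Finset.range J, τ ^ j / (j.factorial : ℝ) *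
      semigroup (rate α) update n s ((generator α)^[j] f) η₀) atTop
      (𝓝 (∑ j ∈ Finset.range J, τ ^ j / (j.factorial : ℝ) * e ((generator α)^[j] f) s)) :=
    tendsto_finsetSum _ fun j _ => (h (hgl j) (hgb j)).const_mul _
  obtain ⟨n₀, hn₀⟩ := (Metric.tendsto_atTop.1 hsum) (ε / 3) (by positivity)
  refine ⟨max n₀ (m + J), fun n hn => ?_⟩
  have h1 := hn₀ n (le_of_max_le_left hn)
  have h2 := hS J n (le_of_max_le_right hn)
  have h3 := he J
  rw [Real.dist_eq] at h1 ⊢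
  rw [abs_lt] at h1 ⊢
  rw [abs_le] at h2 h3
  constructor <;> linarith [h1.1, h1.2, h2.1, h2.2, h3.1, h3.2]

/-- The forward equation for local functions determines a one-time marginal: it is the limit of
the finite systems. -/
lemma tendsto_semigroup_of_forward (hα : 0 ≤ α) {e : (Config → ℝ) → ℝ → ℝ}
    (h0 : ∀ {f : Config → ℝ} {B : ℝ}, IsLocal f → (∀ η, |f η| ≤ B) → e f 0 = f η₀)
    (hb : ∀ {f : Config → ℝ} {B : ℝ}, IsLocal f → (∀ η, |f η| ≤ B) → ∀ s, |e f s| ≤ B)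
    (hc : ∀ {f : Config → ℝ} {B : ℝ}, IsLocal f → (∀ η, |f η| ≤ B) →
      ContinuousOn (e f) (Set.Ici 0))
    (hd : ∀ {f : Config → ℝ} {B : ℝ}, IsLocal f → (∀ η, |f η| ≤ B) →
      ∀ s, 0 ≤ s → HasDerivWithinAt (e f) (e (generator α f) s) (Set.Ici s) s)
    {t : ℝ} (ht : 0 ≤ t) {f : Config → ℝ} {B : ℝ} (hf : IsLocal f) (hB : ∀ η, |f η| ≤ B) :
    Tendsto (fun n => semigroup (rate α) update n t f η₀) atTop (𝓝 (e f t)) := by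
  -- Time advances by steps of `1 / 8`. The induction is over all local `f` at once, because the
  -- expansion of `f` involves its iterated generators.
  have key : ∀ (k : ℕ) (t : ℝ), 0 ≤ t → t ≤ k / 8 → ∀ {f : Config → ℝ} {B : ℝ}, IsLocal f →
      (∀ η, |f η| ≤ B) →
      Tendsto (fun n => semigroup (rate α) update n t f η₀) atTop (𝓝 (e f t)) := by
    intro k
    induction k with
    | zero =>
      intro t ht ht' f B hf hB
      obtain rfl : t = 0 := by simp at ht'; linarith
      simp only [semigroup_zero, h0 hf hB, tendsto_const_nhds]
    | succ k ih =>
      intro t ht ht' f B hf hB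
      push_cast at ht'
      rcases le_total t (1 / 8) with h | h
      · have := tendsto_semigroup_step (s := 0) (τ := t) hα hb hc hd le_rfl ht h
          (ih 0 le_rfl (by positivity)) hf hB
        simpa using this
      · have := tendsto_semigroup_step (s := t - 1 / 8) (τ := 1 / 8) hα hb hc hd (by linarith)
          (by norm_num) le_rfl (ih (t - 1 / 8) (by linarith) (by linarith)) hf hB
        simpa using this
  obtain ⟨k, hk⟩ := exists_nat_ge (8 * t)
  exact key k t ht (by linarith) hf hB

end Convergence

/-! ### From the martingale problem to the forward equation. -/

section Marginals

lemma finite_abs_le (m : ℕ) : {x : Site | |(x : ℤ)| ≤ m}.Finite := by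
  refine Set.Finite.of_finite_image (f := fun x : Site => (x : ℤ)) ?_ Subtype.val_injective.injOn
  refine (Set.finite_Icc (-(m : ℤ)) m).subset ?_
  rintro _ ⟨x, hx, rfl⟩
  exact abs_le.1 hx

/-- A local function factors through finitely many coordinates with countably many values, where
every function is measurable. -/
lemma IsLocal.measurable {f : Config → ℝ} (hf : IsLocal f) : Measurable f := by
  obtain ⟨m, hf⟩ := hf
  have := (finite_abs_le m).to_subtype
  obtain ⟨g, rfl⟩ := dependsOn_iff_exists_comp.1 hf
  have hg : Measurable g := measurable_of_countable g
  exact hg.comp (measurable_pi_lambda _ fun x => measurable_pi_apply _)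

lemma IsLocal.generator {α : ℝ} {f : Config → ℝ} (hf : IsLocal f) : IsLocal (generator α f) := by
  obtain ⟨m, hf⟩ := hf
  exact (LocalIn.generator hf).isLocal

variable {α : ℝ} {η₀ : Config} {Ω : Type*} [mΩ : MeasurableSpace Ω] {P : Measure Ω}
  {ξ : ℝ≥0 → Ω → Config}

namespace IsHalfSpaceTASEP

lemma measurable (hξ : IsHalfSpaceTASEP α η₀ P ξ) (t : ℝ≥0) : Measurable (ξ t) := by
  obtain ⟨ℱ, hℱ, -⟩ := hξ.martingale
  exact measurable_pi_lambda _ fun x => (hℱ t x).mono (ℱ.le t) le_rfl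

lemma eventually_eq (hξ : IsHalfSpaceTASEP α η₀ P ξ) {f : Config → ℝ} (hf : IsLocal f) (ω : Ω)
    (t : ℝ≥0) : ∀ᶠ s in 𝓝[>] t, f (ξ s ω) = f (ξ t ω) := by
  obtain ⟨m, hf⟩ := hf
  have : ∀ᶠ s in 𝓝[>] t, ∀ x ∈ {x : Site | |(x : ℤ)| ≤ m}, ξ s ω x = ξ t ω x :=
    (Set.Finite.eventually_all (finite_abs_le m)).2 fun x _ => hξ.right_continuous ω x t
  exact this.mono fun s hs => hf hs

lemma measurable_uncurry_comp (hξ : IsHalfSpaceTASEP α η₀ P ξ) {f : Config → ℝ} (hf : IsLocal f)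
    (v : ℕ → ℝ≥0) {κ : ℝ≥0 → ℕ} (hκ : Measurable κ) :
    Measurable fun p : ℝ≥0 × Ω => f (ξ (v (κ p.1)) p.2) := by
  have h1 : Measurable fun p : ℕ × Ω => f (ξ (v p.1) p.2) :=
    measurable_from_prod_countable_right fun k => hf.measurable.comp (hξ.measurable (v k))
  exact h1.comp ((hκ.comp measurable_fst).prodMk measurable_snd)

/-- A right-continuous process is jointly measurable. -/
lemma measurable_uncurry (hξ : IsHalfSpaceTASEP α η₀ P ξ) {f : Config → ℝ} (hf : IsLocal f) :
    Measurable fun p : ℝ≥0 × Ω => f (ξ p.1 p.2) := by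
  -- The next grid point strictly to the right of `s`: it takes countably many values and tends to
  -- `s` from the side on which the paths are continuous.
  obtain ⟨u, hu_def⟩ : ∃ u : ℕ → ℝ≥0 → ℝ≥0, ∀ n s,
      u n s = ((⌊s * ((n : ℝ≥0) + 1)⌋₊ : ℝ≥0) + 1) / ((n : ℝ≥0) + 1) := ⟨_, fun _ _ => rfl⟩
  have hu : ∀ n, Measurable fun p : ℝ≥0 × Ω => f (ξ (u n p.1) p.2) := by
    intro n
    have hκ : Measurable fun s : ℝ≥0 => ⌊s * ((n : ℝ≥0) + 1)⌋₊ := by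
      have h : Measurable fun s : ℝ≥0 => s * ((n : ℝ≥0) + 1) := by fun_prop
      exact h.nat_floor
    have := hξ.measurable_uncurry_comp hf (fun k => ((k : ℝ≥0) + 1) / ((n : ℝ≥0) + 1)) hκ
    simpa only [hu_def] using this
  refine measurable_of_tendsto_metrizable hu ?_
  rw [tendsto_pi_nhds]
  rintro ⟨s, ω⟩
  have hlt : ∀ n, s < u n s := by
    intro n
    rw [hu_def, lt_div_iff₀ (by positivity)]
    exact Nat.lt_floor_add_one _
  have hle : ∀ n, u n s ≤ s + 1 / ((n : ℝ≥0) + 1) := by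
    intro n
    rw [hu_def, div_le_iff₀ (by positivity), add_mul, one_div, inv_mul_cancel₀ (by positivity)]
    gcongr
    exact Nat.floor_le (by positivity)
  have hlim : Tendsto (fun n => u n s) atTop (𝓝[>] s) := by
    refine tendsto_nhdsWithin_iff.2 ⟨?_, Eventually.of_forall hlt⟩
    refine tendsto_of_tendsto_of_tendsto_of_le_of_le tendsto_const_nhds ?_ (fun n => (hlt n).le) hle
    have := (tendsto_one_div_add_atTop_nhds_zero_nat (𝕜 := ℝ≥0)).const_add s
    simpa using this
  exact tendsto_nhds_of_eventually_eq (hlim.eventually (hξ.eventually_eq hf ω s))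

variable [IsProbabilityMeasure P]

lemma integrable (hξ : IsHalfSpaceTASEP α η₀ P ξ) {f : Config → ℝ} {B : ℝ} (hf : IsLocal f)
    (hB : ∀ η, |f η| ≤ B) (t : ℝ≥0) : Integrable (fun ω => f (ξ t ω)) P :=
  .of_bound (hf.measurable.comp (hξ.measurable t)).aestronglyMeasurable B
    (Eventually.of_forall fun _ => hB _)

lemma abs_integral_le {f : Config → ℝ} {B : ℝ} (hB : ∀ η, |f η| ≤ B) (t : ℝ≥0) :
    |∫ ω, f (ξ t ω) ∂P| ≤ B := by
  have := norm_integral_le_of_norm_le_const (μ := P) (f := fun ω => f (ξ t ω))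
    (Eventually.of_forall fun ω => hB _)
  simpa using this

/-- The Kolmogorov forward equation. -/
lemma integral_eq (hξ : IsHalfSpaceTASEP α η₀ P ξ) (hα : 0 ≤ α) {f : Config → ℝ} {B : ℝ}
    (hf : IsLocal f) (hB : ∀ η, |f η| ≤ B) {t : ℝ} (ht : 0 ≤ t) :
    ∫ ω, f (ξ t.toNNReal ω) ∂P =
      f η₀ + ∫ s in (0 : ℝ)..t, ∫ ω, generator α f (ξ s.toNNReal ω) ∂P := by
  obtain ⟨m, hm⟩ := id hf
  have hgB := LocalIn.abs_generator_le hα hm hB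
  obtain ⟨ℱ, -, hmart⟩ := hξ.martingale
  have hM := hmart f hf ⟨B, hB⟩
  have h1 := hM.setIntegral_eq (zero_le : 0 ≤ t.toNNReal) MeasurableSet.univ
  simp only [Measure.restrict_univ, NNReal.coe_zero, intervalIntegral.integral_same, sub_zero,
    Real.coe_toNNReal t ht] at h1
  have h0 : ∫ ω, f (ξ 0 ω) ∂P = f η₀ := by
    rw [integral_congr_ae (g := fun _ => f η₀) (hξ.init.mono fun ω hω => by simp [hω])]
    simp
  have hmeas : Measurable fun p : Ω × ℝ => generator α f (ξ p.2.toNNReal p.1) :=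
    (hξ.measurable_uncurry hf.generator).comp
      ((measurable_real_toNNReal.comp measurable_snd).prodMk measurable_fst)
  have hint : Integrable (Function.uncurry fun ω (s : ℝ) => generator α f (ξ s.toNNReal ω))
      (P.prod (volume.restrict (Set.Ioc 0 t))) :=
    .of_bound hmeas.aestronglyMeasurable _ (Eventually.of_forall fun p => hgB _)
  have hswap : ∫ ω, (∫ s in (0 : ℝ)..t, generator α f (ξ s.toNNReal ω)) ∂P =
      ∫ s in (0 : ℝ)..t, ∫ ω, generator α f (ξ s.toNNReal ω) ∂P := by
    simp only [intervalIntegral.integral_of_le ht]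
    exact integral_integral_swap hint
  have hI : Integrable (fun ω => ∫ s in (0 : ℝ)..t, generator α f (ξ s.toNNReal ω)) P := by
    simp only [intervalIntegral.integral_of_le ht]
    exact hint.integral_prod_left
  rw [integral_sub (hξ.integrable hf hB _) hI, hswap, h0] at h1
  linarith

lemma continuous_integral (hξ : IsHalfSpaceTASEP α η₀ P ξ) (hα : 0 ≤ α) {f : Config → ℝ} {B : ℝ}
    (hf : IsLocal f) (hB : ∀ η, |f η| ≤ B) :
    Continuous fun t : ℝ => ∫ ω, f (ξ t.toNNReal ω) ∂P := by
  obtain ⟨m, hm⟩ := id hf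
  have hgB := LocalIn.abs_generator_le hα hm hB
  have hmeas : StronglyMeasurable fun s : ℝ => ∫ ω, generator α f (ξ s.toNNReal ω) ∂P := by
    have : Measurable fun p : ℝ × Ω => generator α f (ξ p.1.toNNReal p.2) :=
      (hξ.measurable_uncurry hf.generator).comp
        ((measurable_real_toNNReal.comp measurable_fst).prodMk measurable_snd)
    exact this.stronglyMeasurable.integral_prod_right
  have hint : ∀ a b : ℝ, IntervalIntegrable
      (fun s : ℝ => ∫ ω, generator α f (ξ s.toNNReal ω) ∂P) volume a b := fun a b =>
    intervalIntegrable_iff.2 (.of_bound (by simp) hmeas.aestronglyMeasurable _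
      (Eventually.of_forall fun s => abs_integral_le hgB _))
  -- The forward equation writes the expectation as a primitive of a bounded function; `max t 0`
  -- accounts for `t.toNNReal` at negative times.
  have h : (fun t : ℝ => ∫ ω, f (ξ t.toNNReal ω) ∂P) = fun t : ℝ =>
      f η₀ + ∫ s in (0 : ℝ)..max t 0, ∫ ω, generator α f (ξ s.toNNReal ω) ∂P := by
    ext t
    rw [← hξ.integral_eq hα hf hB (le_max_right t 0)]
    simp [Real.toNNReal]
  rw [h]
  exact continuous_const.add ((intervalIntegral.continuous_primitive hint 0).comp (by fun_prop))

/-- The expectations of local functions satisfy the hypotheses of `tendsto_semigroup_of_forward`. In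
particular all solutions of the martingale problem with the same initial condition share their
one-time marginals. -/
lemma tendsto_semigroup_of_isLocal (hξ : IsHalfSpaceTASEP α η₀ P ξ) (hα : 0 ≤ α)
    {f : Config → ℝ} {B : ℝ} (hf : IsLocal f) (hB : ∀ η, |f η| ≤ B) (t : ℝ≥0) :
    Tendsto (fun n => semigroup (rate α) update n t f η₀) atTop (𝓝 (∫ ω, f (ξ t ω) ∂P)) := by
  have := tendsto_semigroup_of_forward (η₀ := η₀) hα
    (e := fun f (s : ℝ) => ∫ ω, f (ξ s.toNNReal ω) ∂P) ?_ ?_ ?_ ?_ t.2 hf hB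
  · simpa using this
  · intro f B hf hB
    simpa using hξ.integral_eq hα hf hB le_rfl
  · exact fun _ hB s => abs_integral_le hB _
  · exact fun hf hB => (hξ.continuous_integral hα hf hB).continuousOn
  · intro f B hf hB s hs
    obtain ⟨m, hm⟩ := id hf
    have hgB := LocalIn.abs_generator_le hα hm hB
    have h1 := ((hξ.continuous_integral hα hf.generator hgB).integral_hasStrictDerivAt 0
      s).hasDerivAt.const_add (f η₀)
    refine h1.hasDerivWithinAt.congr (fun u hu => ?_) ?_
    · exact hξ.integral_eq hα hf hB (hs.trans hu)
    · exact hξ.integral_eq hα hf hB hs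

end IsHalfSpaceTASEP

end Marginals


/-! ### Tightness: how far particles can travel. -/

/-- A nested sequence of regions such that the clock `k` moves nothing into the `j`-th region from
outside unless `k = j`, in which case it comes from the preceding region. -/
structure IsExhaustion (D : ℕ → Set Site) : Prop where
  anti : ∀ j, D (j + 1) ⊆ D j
  stable : ∀ {j k η} {x : Site}, k ≠ j → x ∈ D j → ∃ y ∈ D j, update k η x = η y
  step : ∀ {j η} {x : Site}, x ∈ D (j + 1) → ∃ y ∈ D j, update (j + 1) η x = η y

/-- Only clock `j` has an edge across the left boundary of `{x > j}`. This family controls the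
particles far to the right. -/
lemma isExhaustion_lt : IsExhaustion fun j => {x : Site | (j : ℤ) < x} where
  anti j x hx := by simp only [Set.mem_ofPred_eq] at *; push_cast at hx; omega
  stable {j k η x} hk hx := by
    simp only [Set.mem_ofPred_eq] at *
    rcases update_apply_cases k η x with h | ⟨y, h, h1, h2, h3⟩
    · exact ⟨x, hx, h⟩
    · refine ⟨y, ?_, h⟩
      rw [abs_of_nonneg (by omega)] at h2
      rcases abs_cases (y : ℤ) with h4 | h4 <;> omega
  step {j η x} hx := by
    simp only [Set.mem_ofPred_eq] at *
    push_cast at hx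
    rcases update_apply_cases (j + 1) η x with h | ⟨y, h, h1, h2, h3⟩
    · exact ⟨x, by omega, h⟩
    · refine ⟨y, ?_, h⟩
      have h0 := h1.resolve_right (Nat.succ_ne_zero j)
      push_cast at h3
      have h5 : (0 : ℤ) < y := h0.1 (by omega)
      rcases abs_cases (y : ℤ) with h4 | h4 <;> omega

/-- The two-sided family is meant for the second class particle, which may also escape to the left.
-/
lemma isExhaustion_lt_abs : IsExhaustion fun j => {x : Site | (j : ℤ) < |(x : ℤ)|} where
  anti j x hx := by simp only [Set.mem_ofPred_eq] at *; push_cast at hx; omega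
  stable {j k η x} hk hx := by
    simp only [Set.mem_ofPred_eq] at *
    rcases update_apply_cases k η x with h | ⟨y, h, h1, h2, h3⟩
    · exact ⟨x, hx, h⟩
    · exact ⟨y, by omega, h⟩
  step {j η x} hx := by
    simp only [Set.mem_ofPred_eq] at *
    push_cast at hx
    rcases update_apply_cases (j + 1) η x with h | ⟨y, h, h1, h2, h3⟩
    · exact ⟨x, by omega, h⟩
    · exact ⟨y, by push_cast at *; omega, h⟩

/-- The configurations which have a color with the property `Q` at a site in `D`. -/
def occupied (D : Set Site) (Q : ℕ∞ → Prop) : Set Config := {η | ∃ x ∈ D, Q (η x)}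

lemma abs_indicator_one_le (A : Set Config) (η : Config) :
    |A.indicator (1 : Config → ℝ) η| ≤ 1 := by
  by_cases h : η ∈ A <;> simp [h]

lemma indicator_one_nonneg (A : Set Config) (η : Config) :
    0 ≤ A.indicator (1 : Config → ℝ) η :=
  Set.indicator_nonneg (fun _ _ => zero_le_one) η

section Tail

variable {α : ℝ} {D : ℕ → Set Site} {Q : ℕ∞ → Prop}

/-- A weighted count of the occupied regions. -/
noncomputable def tailWeight (D : ℕ → Set Site) (Q : ℕ∞ → Prop) (m : ℕ) (η : Config) : ℝ :=
  1 + ∑ j ∈ Finset.range (m + 1), 2 ^ j * (occupied (D j) Q).indicator 1 η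

lemma indicator_occupied_update_le (hD : IsExhaustion D) {j k : ℕ} (hjk : k ≠ j) (η : Config) :
    (occupied (D j) Q).indicator (1 : Config → ℝ) (update k η) ≤
      (occupied (D j) Q).indicator 1 η := by
  by_cases h : update k η ∈ occupied (D j) Q
  · obtain ⟨x, hx, hQ⟩ := h
    obtain ⟨y, hy, e⟩ := hD.stable (η := η) hjk hx
    have : η ∈ occupied (D j) Q := ⟨y, hy, e ▸ hQ⟩
    rw [Set.indicator_of_mem this]
    exact (le_abs_self _).trans (abs_indicator_one_le _ _)
  · rw [Set.indicator_of_notMem h]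
    exact indicator_one_nonneg _ _

lemma indicator_occupied_update_succ_le (hD : IsExhaustion D) (j : ℕ) (η : Config) :
    (occupied (D (j + 1)) Q).indicator (1 : Config → ℝ) (update (j + 1) η) ≤
      (occupied (D j) Q).indicator 1 η := by
  by_cases h : update (j + 1) η ∈ occupied (D (j + 1)) Q
  · obtain ⟨x, hx, hQ⟩ := h
    obtain ⟨y, hy, e⟩ := hD.step (η := η) hx
    have : η ∈ occupied (D j) Q := ⟨y, hy, e ▸ hQ⟩
    rw [Set.indicator_of_mem this]
    exact (le_abs_self _).trans (abs_indicator_one_le _ _)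
  · rw [Set.indicator_of_notMem h]
    exact indicator_one_nonneg _ _

lemma rate_le {α : ℝ} (hα : 0 ≤ α) (k : ℕ) : rate α k ≤ α + 1 := by
  cases k <;> simp [rate, hα]

lemma jumpOp_indicator_occupied_le (hα : 0 ≤ α) {n j : ℕ} {η : Config} {b : ℝ} (hb : 0 ≤ b)
    (hD : IsExhaustion D)
    (hj : (occupied (D j) Q).indicator (1 : Config → ℝ) (update j η) ≤ b) :
    jumpOp (rate α) update n ((occupied (D j) Q).indicator 1) η ≤
      totalRate (rate α) n * (occupied (D j) Q).indicator 1 η + (α + 1) * b := by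
  have h0 := indicator_one_nonneg (occupied (D j) Q) η
  -- Only clock `j` can make an unoccupied `D j` occupied, and its rate is at most `α + 1`.
  have h1 : ∀ k, rate α k * (occupied (D j) Q).indicator (1 : Config → ℝ) (update k η) ≤
      rate α k * (occupied (D j) Q).indicator 1 η + if k = j then (α + 1) * b else 0 := by
    intro k
    split_ifs with h
    · subst h
      have := mul_le_mul (rate_le hα k) hj (indicator_one_nonneg _ _) (by positivity)
      have := mul_nonneg (rate_nonneg hα k) h0
      linarith
    · rw [add_zero]
      exact mul_le_mul_of_nonneg_left (indicator_occupied_update_le hD h η) (rate_nonneg hα k)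
  rw [jumpOp_apply]
  refine (Finset.sum_le_sum fun k _ => h1 k).trans ?_
  rw [Finset.sum_add_distrib, ← Finset.sum_mul, totalRate]
  refine add_le_add_right ?_ _
  rw [Finset.sum_ite_eq']
  split_ifs
  · exact le_rfl
  · positivity

lemma tailWeight_nonneg (m : ℕ) (η : Config) : 0 ≤ tailWeight D Q m η :=
  add_nonneg zero_le_one (Finset.sum_nonneg fun j _ =>
    mul_nonneg (by positivity) (indicator_one_nonneg _ _))

lemma jumpOp_tailWeight_le (hα : 0 ≤ α) (hD : IsExhaustion D) (m n : ℕ) (η : Config) :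
    jumpOp (rate α) update n (tailWeight D Q m) η ≤
      (totalRate (rate α) n + 2 * (α + 1)) * tailWeight D Q m η := by
  -- Region `j` is fed from region `j - 1`. Nothing restricts entries into `D 0`; the summand `1` of
  -- `tailWeight` pays for them.
  let prev : ℕ → ℝ := fun j => match j with
    | 0 => 1
    | j + 1 => (occupied (D j) Q).indicator 1 η
  have hprev : ∀ j, jumpOp (rate α) update n ((occupied (D j) Q).indicator 1) η ≤
      totalRate (rate α) n * (occupied (D j) Q).indicator 1 η + (α + 1) * prev j := by
    intro j
    cases j with
    | zero =>
      exact jumpOp_indicator_occupied_le hα zero_le_one hD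
        ((le_abs_self _).trans (abs_indicator_one_le _ _))
    | succ j =>
      exact jumpOp_indicator_occupied_le (b := (occupied (D j) Q).indicator 1 η) hα
        (indicator_one_nonneg _ _) hD (indicator_occupied_update_succ_le hD j η)
  have e : tailWeight D Q m = (fun _ => (1 : ℝ)) + ∑ j ∈ Finset.range (m + 1),
      (2 : ℝ) ^ j • (occupied (D j) Q).indicator (1 : Config → ℝ) := by
    ext η
    simp [tailWeight, Finset.sum_apply]
  have h1 : jumpOp (rate α) update n (tailWeight D Q m) η =
      totalRate (rate α) n + ∑ j ∈ Finset.range (m + 1),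
        2 ^ j * jumpOp (rate α) update n ((occupied (D j) Q).indicator 1) η := by
    rw [e, map_add, map_sum, Pi.add_apply, Finset.sum_apply]
    congr 1
    · simp [jumpOp_apply, totalRate]
    · exact Finset.sum_congr rfl fun j _ => by rw [map_smul]; rfl
  -- Shifting the index by one in the weights `2 ^ j` costs the factor `2`.
  have h2 : ∑ j ∈ Finset.range (m + 1), 2 ^ j * prev j ≤ 2 * tailWeight D Q m η := by
    rw [Finset.sum_range_succ', tailWeight, Finset.sum_range_succ, mul_add, mul_add]
    have h3 : ∑ j ∈ Finset.range m, 2 ^ (j + 1) * prev (j + 1) =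
        2 * ∑ j ∈ Finset.range m, 2 ^ j * (occupied (D j) Q).indicator 1 η := by
      rw [Finset.mul_sum]
      exact Finset.sum_congr rfl fun j _ => by simp only [prev, pow_succ]; ring
    have h4 : 0 ≤ 2 ^ m * (occupied (D m) Q).indicator (1 : Config → ℝ) η :=
      mul_nonneg (by positivity) (indicator_one_nonneg _ _)
    rw [h3]
    simp only [prev]
    linarith
  rw [h1]
  calc _ ≤ totalRate (rate α) n + ∑ j ∈ Finset.range (m + 1),
        2 ^ j * (totalRate (rate α) n * (occupied (D j) Q).indicator 1 η + (α + 1) * prev j) := by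
        gcongr with j _
        exact hprev j
    _ = totalRate (rate α) n * tailWeight D Q m η +
        (α + 1) * ∑ j ∈ Finset.range (m + 1), 2 ^ j * prev j := by
        rw [tailWeight, mul_add, mul_one, Finset.mul_sum, Finset.mul_sum, add_assoc,
          ← Finset.sum_add_distrib]
        congr 1
        exact Finset.sum_congr rfl fun j _ => by ring
    _ ≤ totalRate (rate α) n * tailWeight D Q m η + (α + 1) * (2 * tailWeight D Q m η) := by
        gcongr
    _ = _ := by ring

lemma tailWeight_le (m : ℕ) (η : Config) : tailWeight D Q m η ≤ 2 ^ (m + 1) := by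
  have h : ∀ j ∈ Finset.range (m + 1), (2 : ℝ) ^ j * (occupied (D j) Q).indicator 1 η ≤ 2 ^ j :=
    fun j _ => mul_le_of_le_one_right (by positivity)
      ((le_abs_self _).trans (abs_indicator_one_le _ _))
  have := Finset.sum_le_sum h
  rw [geom_sum_eq (by norm_num)] at this
  rw [tailWeight]
  linarith

/-- Only regions with index below `x₀` contribute, and `1 + ∑ j < x₀, 2 ^ j = 2 ^ x₀`, whatever `m`
is. -/
lemma tailWeight_le_of_notMem {η : Config} {x₀ : ℕ} (h : ∀ j, x₀ ≤ j → η ∉ occupied (D j) Q)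
    (m : ℕ) : tailWeight D Q m η ≤ 2 ^ x₀ := by
  induction m with
  | zero =>
    rcases Nat.eq_zero_or_pos x₀ with rfl | h0
    · simp [tailWeight, h 0 le_rfl]
    · refine (tailWeight_le 0 η).trans ?_
      exact pow_le_pow_right₀ (by norm_num) (by omega)
  | succ m ih =>
    by_cases hm : x₀ ≤ m + 1
    · have : tailWeight D Q (m + 1) η = tailWeight D Q m η := by
        rw [tailWeight, Finset.sum_range_succ, Set.indicator_of_notMem (h _ hm)]
        simp [tailWeight]
      rwa [this]
    · refine (tailWeight_le _ η).trans ?_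
      exact pow_le_pow_right₀ (by norm_num) (by omega)

/-- The finite systems are tight, uniformly in their size. -/
lemma semigroup_occupied_le (hα : 0 ≤ α) (hD : IsExhaustion D) {η : Config} {x₀ : ℕ}
    (h : ∀ j, x₀ ≤ j → η ∉ occupied (D j) Q) {t : ℝ} (ht : 0 ≤ t) (n m : ℕ) :
    semigroup (rate α) update n t ((occupied (D m) Q).indicator 1) η ≤
      2 ^ x₀ * Real.exp (2 * (α + 1) * t) * (1 / 2) ^ m := by
  have hr := rate_nonneg hα
  -- The rescaled weight still dominates the indicator of an occupied `D m`, while its initial value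
  -- is of order `2 ^ (-m)`.
  let g : Config → ℝ := (1 / 2 : ℝ) ^ m • tailWeight D Q m
  have hg : ∀ η, |g η| ≤ 2 := by
    intro η
    change |(1 / 2 : ℝ) ^ m * tailWeight D Q m η| ≤ 2
    rw [abs_of_nonneg (mul_nonneg (by positivity) (tailWeight_nonneg m η))]
    calc (1 / 2 : ℝ) ^ m * tailWeight D Q m η ≤ (1 / 2) ^ m * 2 ^ (m + 1) := by
          gcongr; exact tailWeight_le m η
      _ = (1 / 2 * 2) ^ m * 2 := by rw [mul_pow]; ring
      _ = 2 := by norm_num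
  have h1 : ∀ η, (occupied (D m) Q).indicator 1 η ≤ g η := by
    intro η
    have : 2 ^ m * (occupied (D m) Q).indicator 1 η ≤ tailWeight D Q m η := by
      rw [tailWeight, Finset.sum_range_succ]
      have : 0 ≤ ∑ j ∈ Finset.range m, 2 ^ j * (occupied (D j) Q).indicator (1 : Config → ℝ) η :=
        Finset.sum_nonneg fun j _ => mul_nonneg (by positivity) (indicator_one_nonneg _ _)
      linarith
    calc _ = (1 / 2 * 2 : ℝ) ^ m * (occupied (D m) Q).indicator 1 η := by norm_num
      _ = (1 / 2) ^ m * (2 ^ m * (occupied (D m) Q).indicator 1 η) := by rw [mul_pow]; ring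
      _ ≤ g η := mul_le_mul_of_nonneg_left this (by positivity)
  calc _ ≤ semigroup (rate α) update n t g η :=
        semigroup_mono hr (p := fun _ => True) (by simp) (abs_indicator_one_le _) hg
          (fun η _ => h1 η) ht trivial
    _ ≤ Real.exp (2 * (α + 1) * t) * g η := by
        refine semigroup_le_exp_mul hr hg (by positivity) (fun η => ?_) ht η
        simp only [g, map_smul, Pi.smul_apply, smul_eq_mul]
        calc _ ≤ (1 / 2 : ℝ) ^ m * ((totalRate (rate α) n + 2 * (α + 1)) * tailWeight D Q m η) := by
              gcongr; exact jumpOp_tailWeight_le hα hD m n η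
          _ = _ := by ring
    _ ≤ Real.exp (2 * (α + 1) * t) * ((1 / 2) ^ m * 2 ^ x₀) := by
        refine mul_le_mul_of_nonneg_left ?_ (Real.exp_pos _).le
        exact mul_le_mul_of_nonneg_left (tailWeight_le_of_notMem h m) (by positivity)
    _ = _ := by ring

lemma tendsto_tail (α t : ℝ) (x₀ : ℕ) :
    Tendsto (fun m : ℕ => 2 ^ x₀ * Real.exp (2 * (α + 1) * t) * (1 / 2 : ℝ) ^ m) atTop (𝓝 0) := by
  have := (tendsto_pow_atTop_nhds_zero_of_lt_one (r := (1 / 2 : ℝ)) (by norm_num)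
    (by norm_num)).const_mul (2 ^ x₀ * Real.exp (2 * (α + 1) * t))
  rwa [mul_zero] at this

end Tail

/-! ### Truncation and convergence for events that are not local. -/

/-- The configuration `η` with all sites outside `[-m, m]` emptied. -/
noncomputable def trunc (m : ℕ) (η : Config) : Config := fun x => if |(x : ℤ)| ≤ m then η x else ⊤

lemma isLocal_comp_trunc (m : ℕ) (f : Config → ℝ) : IsLocal fun η => f (trunc m η) := by
  refine ⟨m, fun η η' h => ?_⟩
  have : trunc m η = trunc m η' := by
    ext1 x
    unfold trunc
    split_ifs with hx
    · exact h x hx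
    · rfl
  simp only [this]

lemma measurableSet_occupied (D : Set Site) (Q : ℕ∞ → Prop) : MeasurableSet (occupied D Q) := by
  have : occupied D Q = ⋃ x ∈ D, (fun η : Config => η x) ⁻¹' {c | Q c} := by
    ext η; simp [occupied]
  rw [this]
  exact MeasurableSet.biUnion (Set.to_countable D) fun x _ =>
    measurable_pi_apply x (Set.to_countable _).measurableSet

lemma isLocal_indicator_occupied (D : Set Site) (Q : ℕ∞ → Prop) (m : ℕ) :
    IsLocal ((occupied (D ∩ {x | |(x : ℤ)| ≤ m}) Q).indicator 1) := by
  refine ⟨m, fun η η' h => ?_⟩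
  have : η ∈ occupied (D ∩ {x | |(x : ℤ)| ≤ m}) Q ↔
      η' ∈ occupied (D ∩ {x | |(x : ℤ)| ≤ m}) Q := by
    refine exists_congr fun x => and_congr_right fun hx => ?_
    rw [h x hx.2]
  by_cases h' : η ∈ occupied (D ∩ {x | |(x : ℤ)| ≤ m}) Q
  · rw [Set.indicator_of_mem h', Set.indicator_of_mem (this.1 h')]; rfl
  · rw [Set.indicator_of_notMem h', Set.indicator_of_notMem (fun h => h' (this.2 h))]

namespace IsHalfSpaceTASEP

variable {α : ℝ} {η₀ : Config} {Ω : Type*} [mΩ : MeasurableSpace Ω] {P : Measure Ω}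
  {ξ : ℝ≥0 → Ω → Config} {D : ℕ → Set Site} {Q : ℕ∞ → Prop}

lemma integral_indicator_comp (hξ : IsHalfSpaceTASEP α η₀ P ξ) {A : Set Config}
    (hA : MeasurableSet A) (t : ℝ≥0) :
    ∫ ω, A.indicator (1 : Config → ℝ) (ξ t ω) ∂P = P.real (ξ t ⁻¹' A) := by
  rw [← integral_indicator_one (hξ.measurable t hA)]
  rfl

variable [IsProbabilityMeasure P]

lemma measureReal_occupied_le (hξ : IsHalfSpaceTASEP α η₀ P ξ) (hα : 0 ≤ α) (hD : IsExhaustion D)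
    {x₀ : ℕ} (h : ∀ j, x₀ ≤ j → η₀ ∉ occupied (D j) Q) (t : ℝ≥0) (m : ℕ) :
    P.real (ξ t ⁻¹' occupied (D m) Q) ≤ 2 ^ x₀ * Real.exp (2 * (α + 1) * t) * (1 / 2) ^ m := by
  have hr := rate_nonneg hα
  -- Restricting to a window makes the event local; the windows increase to the whole region, and
  -- the bound does not depend on them.
  let A : ℕ → Set Config := fun M => occupied (D m ∩ {x | |(x : ℤ)| ≤ M}) Q
  have hA : ∀ M, A M ⊆ occupied (D m) Q := fun M η ⟨x, hx, hQ⟩ => ⟨x, hx.1, hQ⟩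
  have h1 : ∀ M, P.real (ξ t ⁻¹' A M) ≤
      2 ^ x₀ * Real.exp (2 * (α + 1) * t) * (1 / 2) ^ m := by
    intro M
    rw [← hξ.integral_indicator_comp (measurableSet_occupied _ _)]
    refine le_of_tendsto (hξ.tendsto_semigroup_of_isLocal hα
      (isLocal_indicator_occupied (D m) Q M) (abs_indicator_one_le _) t)
      (Eventually.of_forall fun n => ?_)
    refine le_trans ?_ (semigroup_occupied_le hα hD h t.2 n m)
    refine semigroup_mono hr (p := fun _ => True) (by simp) (abs_indicator_one_le _)
      (abs_indicator_one_le _) (fun η _ => ?_) t.2 trivial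
    exact Set.indicator_le_indicator_of_subset (hA M) (fun _ => zero_le_one) η
  have hmono : Monotone fun M => ξ t ⁻¹' A M := by
    intro M M' hM ω ⟨x, hx, hQ⟩
    exact ⟨x, ⟨hx.1, le_trans (α := ℤ) hx.2 (by exact_mod_cast hM)⟩, hQ⟩
  have hU : ξ t ⁻¹' occupied (D m) Q = ⋃ M, ξ t ⁻¹' A M := by
    ext ω
    simp only [Set.mem_iUnion]
    refine ⟨fun ⟨x, hx, hQ⟩ => ⟨|(x : ℤ)|.toNat, x, ⟨hx, ?_⟩, hQ⟩, fun ⟨M, hM⟩ => hA M hM⟩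
    simp
  have hlim := tendsto_measure_iUnion_atTop (μ := P) hmono
  rw [← hU] at hlim
  exact le_of_tendsto ((ENNReal.tendsto_toReal (measure_ne_top _ _)).comp hlim)
    (Eventually.of_forall h1)

lemma ae_exists_notMem_occupied (hξ : IsHalfSpaceTASEP α η₀ P ξ) (hα : 0 ≤ α)
    (hD : IsExhaustion D) {x₀ : ℕ} (h : ∀ j, x₀ ≤ j → η₀ ∉ occupied (D j) Q) (t : ℝ≥0) :
    ∀ᵐ ω ∂P, ∃ m, ξ t ω ∉ occupied (D m) Q := by
  have h1 : P.real {ω | ¬ ∃ m, ξ t ω ∉ occupied (D m) Q} ≤ 0 := by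
    refine ge_of_tendsto (tendsto_tail α t x₀) (Eventually.of_forall fun m => ?_)
    refine (measureReal_mono fun ω hω => ?_).trans (hξ.measureReal_occupied_le hα hD h t m)
    by_contra h'
    exact hω ⟨m, h'⟩
  have h2 := le_antisymm h1 measureReal_nonneg
  rw [measureReal_eq_zero_iff] at h2
  exact h2

lemma notMem_occupied_mono (hD : IsExhaustion D) {η : Config} {m m' : ℕ} (hm : m ≤ m')
    (h : η ∉ occupied (D m) Q) : η ∉ occupied (D m') Q := by
  rintro ⟨x, hx, hQ⟩
  exact h ⟨x, antitone_nat_of_succ_le hD.anti hm hx, hQ⟩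

/-- Convergence of the finite systems for events that can be read off from a finite window as soon
as the remote regions are not occupied. -/
lemma tendsto_semigroup_indicator (hξ : IsHalfSpaceTASEP α η₀ P ξ) (hα : 0 ≤ α)
    (hD : IsExhaustion D) {x₀ : ℕ} (h : ∀ j, x₀ ≤ j → η₀ ∉ occupied (D j) Q) {A : Set Config}
    (hA : ∀ m η, η ∉ occupied (D m) Q → (trunc m η ∈ A ↔ η ∈ A)) (t : ℝ≥0) :
    NullMeasurableSet (ξ t ⁻¹' A) P ∧
    Tendsto (fun n => semigroup (rate α) update n t (A.indicator 1) η₀) atTop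
      (𝓝 (P.real (ξ t ⁻¹' A))) := by
  have hr := rate_nonneg hα
  let F : ℕ → Config → ℝ := fun m η => A.indicator 1 (trunc m η)
  have hF : ∀ m, IsLocal (F m) := fun m => isLocal_comp_trunc m _
  have hF1 : ∀ m η, |F m η| ≤ 1 := fun m η => abs_indicator_one_le A _
  have hFA : ∀ m η, η ∉ occupied (D m) Q → F m η = A.indicator 1 η := by
    intro m η hη
    by_cases hηA : η ∈ A
    · simp [F, hηA, (hA m η hη).2 hηA]
    · have : trunc m η ∉ A := fun h => hηA ((hA m η hη).1 h)
      simp [F, hηA, this]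
  have hFA' : ∀ m η, |F m η - A.indicator 1 η| ≤ (occupied (D m) Q).indicator 1 η := by
    intro m η
    by_cases hη : η ∈ occupied (D m) Q
    · rw [Set.indicator_of_mem hη, abs_le]
      have h1 := abs_le.1 (hF1 m η)
      have h2 := indicator_one_nonneg A η
      have h3 := abs_le.1 (abs_indicator_one_le A η)
      have h4 : 0 ≤ F m η := indicator_one_nonneg A _
      simp only [Pi.one_apply]
      constructor <;> linarith [h1.2, h3.2]
    · rw [hFA m η hη, sub_self, abs_zero]
      exact indicator_one_nonneg _ _
  -- `A` is not assumed to be measurable; its indicator along the process is an almost sure limit of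
  -- local functions.
  have hae : AEMeasurable (fun ω => A.indicator (1 : Config → ℝ) (ξ t ω)) P := by
    refine aemeasurable_of_tendsto_metrizable_ae atTop (f := fun m ω => F m (ξ t ω))
      (fun m => ((hF m).measurable.comp (hξ.measurable t)).aemeasurable) ?_
    filter_upwards [hξ.ae_exists_notMem_occupied hα hD h t] with ω ⟨m, hm⟩
    refine tendsto_nhds_of_eventually_eq ?_
    filter_upwards [eventually_ge_atTop m] with m' hm'
    exact hFA m' _ (notMem_occupied_mono hD hm' hm)
  have hnull : NullMeasurableSet (ξ t ⁻¹' A) P := by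
    have := hae.nullMeasurableSet_preimage (measurableSet_singleton (1 : ℝ))
    convert this using 1
    ext ω
    by_cases hω : ξ t ω ∈ A <;> simp [hω]
  refine ⟨hnull, ?_⟩
  have hint : P.real (ξ t ⁻¹' A) = ∫ ω, A.indicator (1 : Config → ℝ) (ξ t ω) ∂P := by
    rw [show (fun ω => A.indicator (1 : Config → ℝ) (ξ t ω)) = (ξ t ⁻¹' A).indicator 1 from rfl,
      integral_indicator₀ hnull]
    simp
  have hEF : ∀ m, |∫ ω, F m (ξ t ω) ∂P - P.real (ξ t ⁻¹' A)| ≤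
      2 ^ x₀ * Real.exp (2 * (α + 1) * t) * (1 / 2) ^ m := by
    intro m
    have hI : Integrable (fun ω => A.indicator (1 : Config → ℝ) (ξ t ω)) P :=
      .of_bound hae.aestronglyMeasurable 1 (Eventually.of_forall fun _ => abs_indicator_one_le A _)
    rw [hint, ← integral_sub (hξ.integrable (hF m) (hF1 m) t) hI]
    refine (abs_integral_le_integral_abs).trans ?_
    refine le_trans ?_ (hξ.measureReal_occupied_le hα hD h t m)
    rw [← hξ.integral_indicator_comp (measurableSet_occupied _ _)]
    refine integral_mono ((hξ.integrable (hF m) (hF1 m) t).sub hI).abs ?_ fun ω => hFA' m _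
    exact (integrable_const (1 : ℝ)).indicator (hξ.measurable t (measurableSet_occupied _ _))
  have hSF : ∀ m n, |semigroup (rate α) update n t (F m) η₀ -
      semigroup (rate α) update n t (A.indicator 1) η₀| ≤
      2 ^ x₀ * Real.exp (2 * (α + 1) * t) * (1 / 2) ^ m := fun m n =>
    (abs_semigroup_sub_le hr (p := fun _ => True) (by simp) (hF1 m) (abs_indicator_one_le A)
      (abs_indicator_one_le _) (fun η _ => hFA' m η) t.2 trivial).trans
      (semigroup_occupied_le hα hD h t.2 n m)
  rw [Metric.tendsto_atTop]
  intro ε hε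
  -- The window is chosen before `n`, which is possible because the tail bound for the finite
  -- systems is uniform in `n`.
  obtain ⟨m, hm⟩ := ((tendsto_tail α t x₀).eventually_lt_const
    (show 0 < ε / 3 by positivity)).exists
  obtain ⟨n₀, hn₀⟩ := (Metric.tendsto_atTop.1
    (hξ.tendsto_semigroup_of_isLocal hα (hF m) (hF1 m) t)) (ε / 3) (by positivity)
  refine ⟨n₀, fun n hn => ?_⟩
  have h1 := hn₀ n hn
  have h2 := hSF m n
  have h3 := hEF m
  rw [Real.dist_eq] at h1 ⊢
  rw [abs_lt] at h1 ⊢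
  rw [abs_le] at h2 h3
  constructor <;> linarith [h1.1, h1.2, h2.1, h2.2, h3.1, h3.2]

end IsHalfSpaceTASEP


/-! ### Signed permutations and their left and right sorting. -/

/-- The reflection `x ↦ -x` of the sites. -/
def mirror : Equiv.Perm Site where
  toFun x := ⟨-x, neg_ne_zero.2 x.2⟩
  invFun x := ⟨-x, neg_ne_zero.2 x.2⟩
  left_inv x := by simp
  right_inv x := by simp

lemma coe_mirror (x : Site) : ((mirror x : Site) : ℤ) = -x := rfl

@[simp] lemma mirror_mirror (x : Site) : mirror (mirror x) = x := by simp [site_eq_iff, coe_mirror]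

lemma mirror_lt_mirror {x y : Site} : mirror x < mirror y ↔ y < x := by
  rw [← Subtype.coe_lt_coe, ← Subtype.coe_lt_coe, coe_mirror, coe_mirror, neg_lt_neg_iff]

lemma mirror_pos (k : ℕ) : mirror (pos k) = neg k := rfl

/-- The left end of the edge of the clock `k` in the closed right half. -/
def leftEnd : ℕ → Site
  | 0 => neg 0
  | k + 1 => pos k

/-- The permutation of the sites which exchanges the ends of the edges of the clock `k`. -/
def reflection : ℕ → Equiv.Perm Site
  | 0 => Equiv.swap (neg 0) (pos 0)
  | k + 1 => Equiv.swap (neg (k + 1)) (neg k) * Equiv.swap (pos k) (pos (k + 1))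

lemma leftEnd_lt (k : ℕ) : leftEnd k < pos k := by
  cases k <;> simp [leftEnd, ← Subtype.coe_lt_coe, coe_pos, coe_neg]

lemma coe_reflection (k : ℕ) (x : Site) : ((reflection k x : Site) : ℤ) =
    if (x : ℤ) = leftEnd k then (k : ℤ) + 1 else if (x : ℤ) = k + 1 then ((leftEnd k : Site) : ℤ)
    else if (x : ℤ) = -(leftEnd k : Site) then -((k : ℤ) + 1) else
    if (x : ℤ) = -((k : ℤ) + 1) then -((leftEnd k : Site) : ℤ) else x := by
  have hx := x.2
  cases k with
  | zero =>
    simp only [reflection, Equiv.swap_apply_def, leftEnd, site_eq_iff, coe_neg, coe_pos]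
    split_ifs <;> (try simp only [coe_neg, coe_pos]) <;> (push_cast at *; omega)
  | succ k =>
    simp only [reflection, Equiv.Perm.mul_apply, Equiv.swap_apply_def, leftEnd, site_eq_iff]
    split_ifs <;> (try simp only [coe_neg, coe_pos] at *) <;> push_cast at * <;> omega

lemma coe_leftEnd (k : ℕ) : ((leftEnd k : Site) : ℤ) = if k = 0 then -1 else (k : ℤ) := by
  cases k <;> simp [leftEnd, coe_pos, coe_neg]

lemma reflection_apply (k : ℕ) (x : Site) : reflection k x =
    if x = leftEnd k then pos k else if x = pos k then leftEnd k else
    if x = mirror (leftEnd k) then mirror (pos k) else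
    if x = mirror (pos k) then mirror (leftEnd k) else x := by
  rw [site_eq_iff, coe_reflection]
  simp only [site_eq_iff, coe_mirror, coe_pos]
  split_ifs <;> rfl

lemma reflection_reflection (k : ℕ) (x : Site) : reflection k (reflection k x) = x := by
  have hx := x.2
  rw [site_eq_iff, coe_reflection, coe_reflection, coe_leftEnd]
  split_ifs <;> omega

lemma reflection_mirror (k : ℕ) (x : Site) :
    reflection k (mirror x) = mirror (reflection k x) := by
  have hx := x.2
  rw [site_eq_iff, coe_mirror, coe_reflection, coe_reflection, coe_leftEnd, coe_mirror]
  split_ifs <;> omega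

lemma reflection_leftEnd (k : ℕ) : reflection k (leftEnd k) = pos k := by
  rw [reflection_apply, if_pos rfl]

lemma reflection_pos (k : ℕ) : reflection k (pos k) = leftEnd k := by
  rw [← reflection_leftEnd, reflection_reflection]

/-- Two sites are the ends of an edge of the clock `k`. -/
def IsEdge (k : ℕ) (x y : Site) : Prop :=
  (x = leftEnd k ∧ y = pos k) ∨ (x = pos k ∧ y = leftEnd k) ∨
  (x = mirror (leftEnd k) ∧ y = mirror (pos k)) ∨ (x = mirror (pos k) ∧ y = mirror (leftEnd k))

/-- Exchanging neighbors only affects the relative order of the neighbors. -/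
lemma reflection_lt_reflection {k : ℕ} {x y : Site} (h : ¬ IsEdge k x y) :
    reflection k x < reflection k y ↔ x < y := by
  have hx := x.2
  have hy := y.2
  simp only [IsEdge, site_eq_iff, coe_mirror, coe_pos, coe_leftEnd] at h
  rw [← Subtype.coe_lt_coe, ← Subtype.coe_lt_coe, coe_reflection, coe_reflection, coe_leftEnd]
  split_ifs at * <;> omega

lemma perm_apply_inv (w : Equiv.Perm Site) (x : Site) : w (w⁻¹ x) = x := w.apply_symm_apply x

lemma perm_inv_apply (w : Equiv.Perm Site) (x : Site) : w⁻¹ (w x) = x := w.symm_apply_apply x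

/-- The group of the finitely supported signed permutations of the sites. -/
def signedPerm : Subgroup (Equiv.Perm Site) where
  carrier := {w | (∀ x, w (mirror x) = mirror (w x)) ∧ {x | w x ≠ x}.Finite}
  one_mem' := ⟨fun _ => rfl, by simp⟩
  mul_mem' := by
    rintro v w ⟨hv, hv'⟩ ⟨hw, hw'⟩
    refine ⟨fun x => by simp [hv, hw], (hv'.union hw').subset fun x hx => ?_⟩
    by_contra h
    simp only [Set.mem_union, Set.mem_ofPred_eq, not_or, not_not] at h
    exact hx (by rw [Equiv.Perm.mul_apply, h.2, h.1])
  inv_mem' := by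
    rintro w ⟨hw, hw'⟩
    refine ⟨fun x => ?_, hw'.subset fun x hx h => hx ?_⟩
    · rw [Equiv.Perm.inv_eq_iff_eq, hw, perm_apply_inv]
    · rw [Equiv.Perm.inv_eq_iff_eq, h]

lemma reflection_mem (k : ℕ) : reflection k ∈ signedPerm := by
  refine ⟨reflection_mirror k, ?_⟩
  refine Set.Finite.subset (s := {leftEnd k, pos k, mirror (leftEnd k), mirror (pos k)})
    (by simp) fun x hx => ?_
  by_contra h
  simp only [Set.mem_insert_iff, Set.mem_singleton_iff, not_or] at h
  exact hx (by simp [reflection_apply, h])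

/-- The simple reflections of the group of signed permutations. -/
def simpleRefl (k : ℕ) : signedPerm := ⟨reflection k, reflection_mem k⟩

lemma simpleRefl_mul_self (k : ℕ) : simpleRefl k * simpleRefl k = 1 :=
  Subtype.ext (Equiv.ext fun x => reflection_reflection k x)

lemma simpleRefl_inv (k : ℕ) : (simpleRefl k)⁻¹ = simpleRefl k :=
  inv_eq_of_mul_eq_one_left (simpleRefl_mul_self k)

/-- Sorting of the contents of the edges of the clock `k`. -/
noncomputable def sortRight (k : ℕ) (w : signedPerm) : signedPerm :=
  if w.1 (leftEnd k) < w.1 (pos k) then w * simpleRefl k else w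

/-- Sorting of the positions of the ends of the edges of the clock `k`. -/
noncomputable def sortLeft (k : ℕ) (w : signedPerm) : signedPerm := (sortRight k w⁻¹)⁻¹

lemma sortLeft_eq (k : ℕ) (w : signedPerm) : sortLeft k w =
    if w.1⁻¹ (leftEnd k) < w.1⁻¹ (pos k) then simpleRefl k * w else w := by
  unfold sortLeft sortRight
  change (if w.1⁻¹ (leftEnd k) < w.1⁻¹ (pos k) then _ else _)⁻¹ = _
  split_ifs <;> simp [simpleRefl_inv]

lemma sortRight_one (k : ℕ) : sortRight k 1 = sortLeft k 1 := by
  have h1 : sortRight k 1 = simpleRefl k := by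
    rw [sortRight, if_pos, one_mul]
    exact leftEnd_lt k
  rw [sortLeft, inv_one, h1, simpleRefl_inv]

/-- Conjugating the reflection in an edge by `w` gives the reflection in the image edge; the
mirrored edge follows along because `w` commutes with `mirror`. -/
lemma IsEdge.mul_simpleRefl {j k : ℕ} {w : signedPerm}
    (h : IsEdge k (w.1 (leftEnd j)) (w.1 (pos j))) : w * simpleRefl j = simpleRefl k * w := by
  have hw := w.2.1
  refine Subtype.ext (Equiv.ext fun x => ?_)
  change w.1 (reflection j x) = reflection k (w.1 x)
  have key : ∀ y, IsEdge k (w.1 (leftEnd j)) (w.1 (pos j)) →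
      (reflection k y = if y = w.1 (leftEnd j) then w.1 (pos j) else
        if y = w.1 (pos j) then w.1 (leftEnd j) else
        if y = mirror (w.1 (leftEnd j)) then mirror (w.1 (pos j)) else
        if y = mirror (w.1 (pos j)) then mirror (w.1 (leftEnd j)) else y) := by
    intro y h
    have hy := y.2
    rw [site_eq_iff, coe_reflection, coe_leftEnd]
    rcases h with ⟨h1, h2⟩ | ⟨h1, h2⟩ | ⟨h1, h2⟩ | ⟨h1, h2⟩ <;> rw [h1, h2] <;>
    simp only [site_eq_iff, mirror_mirror, coe_mirror, coe_pos, coe_leftEnd] <;>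
    split_ifs <;> simp only [coe_mirror, coe_pos, coe_leftEnd] <;> (try split_ifs) <;> omega
  rw [key _ h, reflection_apply]
  simp only [← hw, w.1.injective.eq_iff]
  split_ifs <;> rfl

/-- Both comparisons say that `w` carries the edge of `j` onto an edge of `k` with its orientation
preserved. -/
lemma IsEdge.lt_iff {j k : ℕ} {w : signedPerm} (h : IsEdge k (w.1 (leftEnd j)) (w.1 (pos j))) :
    w.1 (leftEnd j) < w.1 (pos j) ↔ w.1⁻¹ (leftEnd k) < w.1⁻¹ (pos k) := by
  have hw := (inv_mem w.2).1
  have hlt := leftEnd_lt k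
  have hlt' := leftEnd_lt j
  have e : ∀ {x y : Site}, w.1 x = y → w.1⁻¹ y = x := fun h => by rw [← h, perm_inv_apply]
  have e' : ∀ {x y : Site}, w.1 x = mirror y → w.1⁻¹ y = mirror x := fun {x y} h => by
    rw [← mirror_mirror y, hw, ← h, perm_inv_apply]
  rcases h with ⟨h1, h2⟩ | ⟨h1, h2⟩ | ⟨h1, h2⟩ | ⟨h1, h2⟩
  · rw [h1, h2, e h1, e h2]
    exact iff_of_true hlt hlt'
  · rw [h1, h2, e h1, e h2]
    exact iff_of_false hlt.le.not_gt hlt'.le.not_gt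
  · rw [h1, h2, e' h1, e' h2, mirror_lt_mirror, mirror_lt_mirror]
    exact iff_of_false hlt.le.not_gt hlt'.le.not_gt
  · rw [h1, h2, e' h1, e' h2, mirror_lt_mirror, mirror_lt_mirror]
    exact iff_of_true hlt hlt'

/-- An edge is mapped to an edge by the inverse permutation. -/
lemma IsEdge.of_inv {j k : ℕ} {w : signedPerm}
    (h : IsEdge j (w.1⁻¹ (leftEnd k)) (w.1⁻¹ (pos k))) :
    IsEdge k (w.1 (leftEnd j)) (w.1 (pos j)) := by
  have hw := w.2.1
  have e : ∀ {x y : Site}, w.1⁻¹ x = y → w.1 y = x := fun h => by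
    rw [← h, perm_apply_inv]
  have e' : ∀ {x y : Site}, w.1⁻¹ x = mirror y → w.1 y = mirror x := fun {x y} h => by
    rw [← mirror_mirror y, hw, ← h, perm_apply_inv]
  rcases h with ⟨h1, h2⟩ | ⟨h1, h2⟩ | ⟨h1, h2⟩ | ⟨h1, h2⟩
  · exact .inl ⟨e h1, e h2⟩
  · exact .inr (.inl ⟨e h2, e h1⟩)
  · exact .inr (.inr (.inl ⟨e' h1, e' h2⟩))
  · exact .inr (.inr (.inr ⟨e' h2, e' h1⟩))

/-- Sorting contents commutes with sorting positions. -/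
lemma sortRight_sortLeft (j k : ℕ) (w : signedPerm) :
    sortRight j (sortLeft k w) = sortLeft k (sortRight j w) := by
  by_cases h : IsEdge k (w.1 (leftEnd j)) (w.1 (pos j))
  · have h1 := h.mul_simpleRefl
    have h2 := h.lt_iff
    by_cases h3 : w.1 (leftEnd j) < w.1 (pos j)
    · have e1 : sortLeft k w = w * simpleRefl j := by rw [sortLeft_eq, if_pos (h2.1 h3), h1]
      have e2 : sortRight j w = simpleRefl k * w := by rw [sortRight, if_pos h3, h1]
      rw [e1, e2, sortRight, sortLeft_eq, if_neg, if_neg, h1]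
      · change ¬ w.1⁻¹ ((reflection k)⁻¹ (leftEnd k)) < w.1⁻¹ ((reflection k)⁻¹ (pos k))
        have : (reflection k)⁻¹ = reflection k := congrArg Subtype.val (simpleRefl_inv k)
        rw [this, reflection_leftEnd, reflection_pos]
        exact (h2.1 h3).le.not_gt
      · change ¬ w.1 (reflection j (leftEnd j)) < w.1 (reflection j (pos j))
        rw [reflection_leftEnd, reflection_pos]
        exact h3.le.not_gt
    · have e1 : sortLeft k w = w := by rw [sortLeft_eq, if_neg (fun h => h3 (h2.2 h))]
      have e2 : sortRight j w = w := by rw [sortRight, if_neg h3]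
      rw [e1, e2, e1]
  -- Otherwise neither multiplication affects the comparison that decides the other, and the
  -- multiplications from the two sides commute.
  · have h1 : (simpleRefl k * w).1 (leftEnd j) < (simpleRefl k * w).1 (pos j) ↔
        w.1 (leftEnd j) < w.1 (pos j) := reflection_lt_reflection h
    have h2 : (w * simpleRefl j).1⁻¹ (leftEnd k) < (w * simpleRefl j).1⁻¹ (pos k) ↔
        w.1⁻¹ (leftEnd k) < w.1⁻¹ (pos k) := by
      have e : (w * simpleRefl j).1⁻¹ = reflection j * w.1⁻¹ :=
        congrArg Subtype.val (show (w * simpleRefl j)⁻¹ = simpleRefl j * w⁻¹ by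
          rw [mul_inv_rev, simpleRefl_inv])
      rw [e]
      exact reflection_lt_reflection fun h' => h h'.of_inv
    rw [sortLeft_eq, sortLeft_eq, sortRight, sortRight]
    by_cases h3 : w.1 (leftEnd j) < w.1 (pos j) <;>
    by_cases h4 : w.1⁻¹ (leftEnd k) < w.1⁻¹ (pos k) <;>
    simp only [h1, h2, h3, h4, if_true, if_false, mul_assoc]

/-! ### Inversion symmetry and projection to colors. -/

/-- The successive action of the clocks in a list. -/
def act {X : Type*} (U : ℕ → X → X) (l : List ℕ) (x : X) : X := l.foldl (fun x k => U k x) x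

lemma act_cons {X : Type*} (U : ℕ → X → X) (k : ℕ) (l : List ℕ) (x : X) :
    act U (k :: l) x = act U l (U k x) := rfl

lemma act_append {X : Type*} (U : ℕ → X → X) (l l' : List ℕ) (x : X) :
    act U (l ++ l') x = act U l' (act U l x) := List.foldl_append

lemma act_comp {X Y : Type*} {U : ℕ → X → X} {V : ℕ → Y → Y} {φ : X → Y}
    (h : ∀ k x, φ (U k x) = V k (φ x)) (l : List ℕ) (x : X) :
    φ (act U l x) = act V l (φ x) := by
  induction l generalizing x with
  | nil => rfl
  | cons k l ih => rw [act_cons, act_cons, ih, h]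

lemma act_sortLeft_sortRight (l : List ℕ) (k : ℕ) (w : signedPerm) :
    act sortLeft l (sortRight k w) = sortRight k (act sortLeft l w) := by
  exact (act_comp (φ := sortRight k) (fun j w => sortRight_sortLeft k j w) l w).symm

/-- At the identity the last right sort may be replaced by a left sort, which then acts first;
commutation does the rest, and the order of the word is reversed. -/
lemma act_sortRight_one (l : List ℕ) : act sortRight l 1 = act sortLeft l.reverse 1 := by
  induction l using List.reverseRecOn with
  | nil => rfl
  | append_singleton l k ih =>
    rw [act_append, ih, List.reverse_append, List.reverse_singleton, List.singleton_append,
      act_cons sortLeft, ← sortRight_one, act_sortLeft_sortRight]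
    rfl

lemma inv_sortLeft (k : ℕ) (w : signedPerm) : (sortLeft k w)⁻¹ = sortRight k w⁻¹ := by
  rw [sortLeft, inv_inv]

/-- With `R` and `L` the two jump operators, which commute and agree at the identity: `R ^ (j + 1)
f` at `1` equals `L (R ^ j f) = R ^ j (L f)` there, and induction applies to `L f`. -/
lemma jumpOp_sortRight_one (r : ℕ → ℝ) (n j : ℕ) (f : signedPerm → ℝ) :
    (jumpOp r sortRight n ^ j) f 1 = (jumpOp r sortLeft n ^ j) f 1 := by
  have hcomm : Commute (jumpOp r sortRight n) (jumpOp r sortLeft n) := by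
    refine LinearMap.ext fun f => funext fun w => ?_
    simp only [Module.End.mul_apply, jumpOp_apply, Finset.mul_sum]
    rw [Finset.sum_comm]
    refine Finset.sum_congr rfl fun k _ => Finset.sum_congr rfl fun l _ => ?_
    rw [sortRight_sortLeft]
    ring
  have h1 : ∀ f : signedPerm → ℝ, jumpOp r sortRight n f 1 = jumpOp r sortLeft n f 1 := fun f => by
    simp only [jumpOp_apply, sortRight_one]
  induction j generalizing f with
  | zero => rfl
  | succ j ih =>
    rw [pow_succ', Module.End.mul_apply, h1, ← Module.End.mul_apply,
      ← (hcomm.pow_left j).eq, Module.End.mul_apply, ih, ← Module.End.mul_apply, ← pow_succ]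

/-- The inverse of the process started from the identity has the same law as the process. -/
lemma semigroup_sortRight_inv (r : ℕ → ℝ) (n : ℕ) (t : ℝ) (f : signedPerm → ℝ) :
    semigroup r sortRight n t f 1 = semigroup r sortRight n t (fun w => f w⁻¹) 1 := by
  have h : ∀ j, (jumpOp r sortRight n ^ j) f 1 = (jumpOp r sortRight n ^ j) (fun w => f w⁻¹) 1 := by
    intro j
    have h1 := jumpOp_pow_comp (r := r) (n := n) (U := sortLeft) (V := sortRight)
      (φ := fun w : signedPerm => w⁻¹) inv_sortLeft (fun w => f w⁻¹) j 1
    rw [inv_one] at h1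
    rw [h1, jumpOp_sortRight_one]
    congr 1
  simp only [semigroup, h]

/-- The process started from `act sortRight l 1` is, up to inversion, the process started from the
identity to which the reversed list is applied afterwards. -/
lemma semigroup_act_sortRight (r : ℕ → ℝ) (n : ℕ) (t : ℝ) (f : signedPerm → ℝ) (l : List ℕ) :
    semigroup r sortRight n t f (act sortRight l 1) =
      semigroup r sortRight n t (fun w => f (act sortRight l.reverse w)⁻¹) 1 := by
  rw [act_sortRight_one, semigroup_comp (U := sortRight) (φ := act sortLeft l.reverse)
    (fun k w => act_sortLeft_sortRight _ k w), semigroup_sortRight_inv]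
  congr 1
  ext w
  have := act_comp (U := sortLeft) (V := sortRight) (φ := fun w : signedPerm => w⁻¹) inv_sortLeft
    l.reverse w⁻¹
  simp only [inv_inv] at this
  rw [Function.comp_apply, ← this, inv_inv]

/-- The projection of a signed permutation to a configuration with fewer colors. -/
def project (φ : Site → ℕ∞) (w : signedPerm) : Config := fun x => φ (w.1 x)

/-- Monotonicity of `φ` turns sorting of `w` into `max` and `min` of colors; an exchange of equal
colors is invisible. The mirror symmetry of `w` makes one comparison decide for both edges of a
clock. -/
lemma project_sortRight {φ : Site → ℕ∞} (hφ : Monotone φ) (k : ℕ) (w : signedPerm) :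
    project φ (sortRight k w) = update k (project φ w) := by
  have hw := w.2.1
  ext1 x
  unfold sortRight
  cases k with
  | zero =>
    rw [update_zero_apply]
    split_ifs with h h1 h2 h1 h2
    · subst h1
      exact (max_eq_right (hφ h.le)).symm ▸ congrArg (fun x => φ (w.1 x)) (reflection_leftEnd 0)
    · subst h2
      exact (min_eq_left (hφ h.le)).symm ▸ congrArg (fun x => φ (w.1 x)) (reflection_pos 0)
    · refine congrArg (fun x => φ (w.1 x)) ?_
      change reflection 0 x = x
      rw [reflection, Equiv.swap_apply_of_ne_of_ne h1 h2]
    · subst h1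
      exact (max_eq_left (hφ (not_lt.1 h))).symm
    · subst h2
      exact (min_eq_right (hφ (not_lt.1 h))).symm
    · rfl
  | succ k =>
    have hn : ∀ j, w.1 (neg j) = mirror (w.1 (pos j)) := fun j => by rw [← hw, mirror_pos]
    rw [update_succ_apply]
    have e1 : ∀ i j, neg i ≠ pos j := fun i j => by
      rw [Ne, site_eq_iff, coe_neg, coe_pos]; omega
    split_ifs with h h1 h2 h3 h4 h1 h2 h3 h4
    · subst h1
      exact (max_eq_right (hφ h.le)).symm ▸
        congrArg (fun x => φ (w.1 x)) (reflection_leftEnd (k + 1))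
    · subst h2
      exact (min_eq_left (hφ h.le)).symm ▸ congrArg (fun x => φ (w.1 x)) (reflection_pos (k + 1))
    · subst h3
      have h' : w.1 (neg (k + 1)) < w.1 (neg k) := by rw [hn, hn, mirror_lt_mirror]; exact h
      refine (max_eq_right (hφ h'.le)).symm ▸ congrArg (fun x => φ (w.1 x)) ?_
      change reflection (k + 1) (neg (k + 1)) = neg k
      rw [← mirror_pos, reflection_mirror, reflection_pos]
      rfl
    · subst h4
      have h' : w.1 (neg (k + 1)) < w.1 (neg k) := by rw [hn, hn, mirror_lt_mirror]; exact h
      refine (min_eq_left (hφ h'.le)).symm ▸ congrArg (fun x => φ (w.1 x)) ?_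
      change reflection (k + 1) (neg k) = neg (k + 1)
      rw [← mirror_pos, ← mirror_pos, reflection_mirror]
      exact congrArg mirror (reflection_leftEnd (k + 1))
    · refine congrArg (fun x => φ (w.1 x)) ?_
      change reflection (k + 1) x = x
      rw [reflection_apply]
      simp only [leftEnd, mirror_pos, h1, h2, h3, h4, if_false]
    · subst h1
      exact (max_eq_left (hφ (not_lt.1 h))).symm
    · subst h2
      exact (min_eq_right (hφ (not_lt.1 h))).symm
    · subst h3
      have h' : w.1 (neg k) ≤ w.1 (neg (k + 1)) := by
        rw [hn, hn, ← not_lt, mirror_lt_mirror]; exact h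
      exact (max_eq_left (hφ h')).symm
    · subst h4
      have h' : w.1 (neg k) ≤ w.1 (neg (k + 1)) := by
        rw [hn, hn, ← not_lt, mirror_lt_mirror]; exact h
      exact (min_eq_right (hφ h')).symm
    · rfl


/-! ### Counting entries in intervals. -/

section Counting

variable {γ : Type*}

/-- The number of entries in `[a, b)` with the property `Q`. -/
noncomputable def numIco (Q : γ → Prop) (c : ℕ → γ) (a b : ℕ) : ℕ := by
  classical exact ((Finset.Ico a b).filter fun j => Q (c j)).card

lemma numIco_add (Q : γ → Prop) (c : ℕ → γ) {a b d : ℕ} (hab : a ≤ b) (hbd : b ≤ d) :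
    numIco Q c a b + numIco Q c b d = numIco Q c a d := by
  classical
  unfold numIco
  rw [← Finset.card_union_of_disjoint, ← Finset.filter_union, Finset.Ico_union_Ico_eq_Ico hab hbd]
  exact Finset.disjoint_filter_filter (Finset.Ico_disjoint_Ico_consecutive a b d)

lemma numIco_congr {Q : γ → Prop} {c c' : ℕ → γ} {a b : ℕ}
    (h : ∀ j, a ≤ j → j < b → (Q (c j) ↔ Q (c' j))) : numIco Q c a b = numIco Q c' a b := by
  classical
  unfold numIco
  congr 1
  refine Finset.filter_congr fun j hj => ?_
  rw [Finset.mem_Ico] at hj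
  exact h j hj.1 hj.2

lemma numIco_comp_perm {p q : ℕ} (Q : γ → Prop) (c : ℕ → γ) {σ : Equiv.Perm ℕ}
    (hσ : ∀ j, σ j ∈ Finset.Ico p q ↔ j ∈ Finset.Ico p q) :
    numIco Q (c ∘ σ) p q = numIco Q c p q := by
  classical
  unfold numIco
  refine Finset.card_bij (fun j _ => σ j) (fun j hj => ?_) (fun i _ j _ h => σ.injective h)
    fun j hj => ⟨σ.symm j, ?_, by simp⟩
  · rw [Finset.mem_filter] at *
    exact ⟨(hσ j).2 hj.1, hj.2⟩
  · rw [Finset.mem_filter] at *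
    refine ⟨(hσ _).1 (by simpa using hj.1), by simpa using hj.2⟩

lemma numIco_le (Q : γ → Prop) (c : ℕ → γ) (a b : ℕ) : numIco Q c a b ≤ b - a := by
  classical
  unfold numIco
  exact (Finset.card_filter_le _ _).trans (by simp)

lemma numIco_eq_iff {Q : γ → Prop} {c : ℕ → γ} {a b : ℕ} :
    numIco Q c a b = b - a ↔ ∀ j, a ≤ j → j < b → Q (c j) := by
  classical
  unfold numIco
  rw [← Nat.card_Ico a b, Finset.card_filter_eq_iff]
  simp only [Finset.mem_Ico, and_imp]

lemma numIco_eq_zero {Q : γ → Prop} {c : ℕ → γ} {a b : ℕ}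
    (h : ∀ j, a ≤ j → j < b → ¬ Q (c j)) : numIco Q c a b = 0 := by
  classical
  unfold numIco
  rw [Finset.card_eq_zero, Finset.filter_eq_empty_iff]
  intro j hj
  rw [Finset.mem_Ico] at hj
  exact h j hj.1 hj.2

lemma numIco_add_numIco_not (Q : γ → Prop) (c : ℕ → γ) (a b : ℕ) :
    numIco Q c a b + numIco (fun x => ¬ Q x) c a b = b - a := by
  classical
  unfold numIco
  rw [← Nat.card_Ico a b, ← Finset.card_filter_add_card_filter_not (s := Finset.Ico a b)
    (fun j => Q (c j))]
  congr!

lemma numIco_eq_ncard (Q : γ → Prop) (c : ℕ → γ) (a b : ℕ) :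
    numIco Q c a b = {j : ℕ | (a ≤ j ∧ j < b) ∧ Q (c j)}.ncard := by
  classical
  unfold numIco
  rw [← Set.ncard_coe_finset]
  congr 1
  ext j
  simp

end Counting

/-! ### Sorting networks on blocks of a sequence. -/

section Sorting

variable {γ : Type*} [LinearOrder γ]

/-- Sorting of the neighboring entries `i` and `i + 1` of a sequence. -/
def sortEdge (i : ℕ) (c : ℕ → γ) : ℕ → γ := fun j =>
  if j = i then max (c i) (c (i + 1)) else if j = i + 1 then min (c i) (c (i + 1)) else c j

/-- The edges of `[p, p + ℓ]` from right to left. -/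
def sweep (p : ℕ) : ℕ → List ℕ
  | 0 => []
  | ℓ + 1 => (p + ℓ) :: sweep p ℓ

/-- Insertion sort of the `ℓ` entries starting from `p`. -/
def insertionSort (p : ℕ) : ℕ → List ℕ
  | 0 => []
  | ℓ + 1 => insertionSort p ℓ ++ sweep p ℓ

/-- A palindromic list of edges that sorts the `ℓ` entries starting from `p`. -/
def sortBlock (p ℓ : ℕ) : List ℕ := insertionSort p ℓ ++ (insertionSort p ℓ).reverse

lemma reverse_sortBlock (p ℓ : ℕ) : (sortBlock p ℓ).reverse = sortBlock p ℓ := by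
  simp [sortBlock]

lemma mem_sweep {p ℓ i : ℕ} : i ∈ sweep p ℓ ↔ p ≤ i ∧ i < p + ℓ := by
  induction ℓ with
  | zero => simp [sweep]
  | succ ℓ ih => rw [sweep, List.mem_cons, ih]; omega

lemma mem_insertionSort {p ℓ i : ℕ} (h : i ∈ insertionSort p ℓ) : p ≤ i ∧ i + 1 < p + ℓ := by
  induction ℓ with
  | zero => simp [insertionSort] at h
  | succ ℓ ih =>
    rw [insertionSort, List.mem_append, mem_sweep] at h
    rcases h with h | h
    · have := ih h
      omega
    · omega

lemma mem_sortBlock {p ℓ i : ℕ} (h : i ∈ sortBlock p ℓ) : p ≤ i ∧ i + 1 < p + ℓ := by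
  rw [sortBlock, List.mem_append, List.mem_reverse, or_self] at h
  exact mem_insertionSort h

/-- `c` is weakly decreasing on `[p, p + ℓ)`. -/
def SortedOn (p ℓ : ℕ) (c : ℕ → γ) : Prop :=
  ∀ i j, p ≤ i → i ≤ j → j < p + ℓ → c j ≤ c i

/-- The invariant of the insertion: all entries except the one at `p + i` are in order, and that one
dominates everything to its right up to `q`. The sweep carries it left to its place. -/
lemma sortedOn_act_sweep {p q i : ℕ} {c : ℕ → γ} (hi : p + i ≤ q)
    (h1 : ∀ a b, p ≤ a → a ≤ b → b ≤ q → a ≠ p + i → b ≠ p + i → c b ≤ c a)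
    (h2 : ∀ b, p + i ≤ b → b ≤ q → c b ≤ c (p + i)) :
    SortedOn p (q + 1 - p) (act sortEdge (sweep p i) c) := by
  induction i generalizing c with
  | zero =>
    intro a b ha hab hb
    change c b ≤ c a
    by_cases h : a = p
    · subst h; exact h2 b (by omega) (by omega)
    · exact h1 a b ha hab (by omega) (by omega) (by omega)
  | succ i ih =>
    rw [sweep, act_cons]
    have e1 : sortEdge (p + i) c (p + i) = max (c (p + i)) (c (p + i + 1)) := by simp [sortEdge]
    have e2 : sortEdge (p + i) c (p + i + 1) = min (c (p + i)) (c (p + i + 1)) := by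
      simp [sortEdge]
    have e3 : ∀ j, j ≠ p + i → j ≠ p + i + 1 → sortEdge (p + i) c j = c j := by
      intro j hj hj'; simp [sortEdge, hj, hj']
    refine ih (by omega) (fun a b ha hab hb ha' hb' => ?_) fun b hb hbq => ?_
    · by_cases hb1 : b = p + i + 1
      · subst hb1
        by_cases ha1 : a = p + i + 1
        · rw [ha1]
        · rw [e2, e3 a ha' ha1]
          exact (min_le_left _ _).trans (h1 a (p + i) ha (by omega) (by omega) (by omega) (by omega))
      · rw [e3 b hb' hb1]
        by_cases ha1 : a = p + i + 1
        · subst ha1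
          rw [e2]
          exact le_min (h1 _ _ (by omega) (by omega) hb (by omega) (by omega)) (h2 b hab hb)
        · rw [e3 a ha' ha1]
          exact h1 a b ha hab hb (by omega) (by omega)
    · rw [e1]
      by_cases hb0 : b = p + i
      · rw [hb0, e1]
      by_cases hb1 : b = p + i + 1
      · rw [hb1, e2]
        exact (min_le_left _ _).trans (le_max_left _ _)
      · rw [e3 b hb0 hb1]
        exact (h2 b (by omega) hbq).trans (le_max_right _ _)

lemma act_apply_of_notMem {l : List ℕ} {c : ℕ → γ} {j : ℕ} (h : ∀ i ∈ l, j ≠ i ∧ j ≠ i + 1) :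
    act sortEdge l c j = c j := by
  induction l generalizing c with
  | nil => rfl
  | cons i l ih =>
    rw [act_cons, ih fun k hk => h k (List.mem_cons_of_mem _ hk)]
    have := h i List.mem_cons_self
    simp [sortEdge, this]

lemma sortedOn_act_insertionSort (p ℓ : ℕ) (c : ℕ → γ) :
    SortedOn p ℓ (act sortEdge (insertionSort p ℓ) c) := by
  induction ℓ with
  | zero => intro i j h1 h2 h3; omega
  | succ ℓ ih =>
    rw [insertionSort, act_append]
    have := sortedOn_act_sweep (p := p) (q := p + ℓ) (i := ℓ) le_rfl
      (fun a b ha hab hb ha' hb' => ih a b ha hab (by omega))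
      (fun b hb hb' => by rw [show b = p + ℓ by omega])
    rwa [show p + ℓ + 1 - p = ℓ + 1 by omega] at this

lemma SortedOn.sortEdge_eq {p ℓ i : ℕ} {c : ℕ → γ} (h : SortedOn p ℓ c) (hi : p ≤ i)
    (hi' : i + 1 < p + ℓ) : sortEdge i c = c := by
  have := h i (i + 1) hi (by omega) hi'
  ext j
  unfold sortEdge
  split_ifs with h1 h2
  · rw [h1, max_eq_left this]
  · rw [h2, min_eq_right this]
  · rfl

lemma SortedOn.act_eq {p ℓ : ℕ} {l : List ℕ} {c : ℕ → γ} (h : SortedOn p ℓ c)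
    (hl : ∀ i ∈ l, p ≤ i ∧ i + 1 < p + ℓ) : act sortEdge l c = c := by
  induction l with
  | nil => rfl
  | cons i l ih =>
    have := hl i List.mem_cons_self
    rw [act_cons, h.sortEdge_eq this.1 this.2, ih fun k hk => hl k (List.mem_cons_of_mem _ hk)]

lemma sortedOn_act_sortBlock (p ℓ : ℕ) (c : ℕ → γ) :
    SortedOn p ℓ (act sortEdge (sortBlock p ℓ) c) := by
  -- The reversed half meets a sorted block and does nothing. It is there to make the word a
  -- palindrome, so that the reversal in the inversion symmetry again gives block sorts.
  rw [sortBlock, act_append, (sortedOn_act_insertionSort p ℓ c).act_eq]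
  · exact sortedOn_act_insertionSort p ℓ c
  · exact fun i hi => mem_insertionSort (List.mem_reverse.1 hi)

lemma act_sortBlock_of_notMem {p ℓ j : ℕ} (c : ℕ → γ) (h : j < p ∨ p + ℓ ≤ j) :
    act sortEdge (sortBlock p ℓ) c j = c j :=
  act_apply_of_notMem fun i hi => by have := mem_sortBlock hi; omega

/-- Sorting rearranges the entries. -/
lemma exists_perm_act (p ℓ : ℕ) {l : List ℕ} (hl : ∀ i ∈ l, p ≤ i ∧ i + 1 < p + ℓ) (c : ℕ → γ) :
    ∃ σ : Equiv.Perm ℕ, act sortEdge l c = c ∘ σ ∧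
      ∀ j, σ j ∈ Finset.Ico p (p + ℓ) ↔ j ∈ Finset.Ico p (p + ℓ) := by
  induction l generalizing c with
  | nil => exact ⟨1, rfl, fun j => Iff.rfl⟩
  | cons i l ih =>
    obtain ⟨σ, h1, h2⟩ := ih (fun k hk => hl k (List.mem_cons_of_mem _ hk)) (sortEdge i c)
    obtain ⟨hi, hi'⟩ := hl i List.mem_cons_self
    rw [act_cons, h1]
    have : ∃ τ : Equiv.Perm ℕ, sortEdge i c = c ∘ τ ∧
        ∀ j, τ j ∈ Finset.Ico p (p + ℓ) ↔ j ∈ Finset.Ico p (p + ℓ) := by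
      rcases le_total (c (i + 1)) (c i) with h | h
      · refine ⟨1, ?_, fun j => Iff.rfl⟩
        ext j
        simp only [sortEdge, max_eq_left h, min_eq_right h, Function.comp_apply,
          Equiv.Perm.one_apply]
        split_ifs with h1 h2 <;> simp [*]
      · refine ⟨Equiv.swap i (i + 1), ?_, fun j => ?_⟩
        · ext j
          simp only [sortEdge, max_eq_right h, min_eq_left h, Function.comp_apply,
            Equiv.swap_apply_def]
          split_ifs <;> rfl
        · rw [Equiv.swap_apply_def]
          simp only [Finset.mem_Ico]
          split_ifs <;> omega
    obtain ⟨τ, h3, h4⟩ := this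
    refine ⟨τ * σ, ?_, fun j => ?_⟩
    · rw [h3]; rfl
    · rw [Equiv.Perm.mul_apply, h4, h2]

lemma numIco_act_sortBlock (p ℓ : ℕ) (Q : γ → Prop) (c : ℕ → γ) :
    numIco Q (act sortEdge (sortBlock p ℓ) c) p (p + ℓ) = numIco Q c p (p + ℓ) := by
  obtain ⟨σ, h1, h2⟩ := exists_perm_act p ℓ (fun i hi => mem_sortBlock hi) c
  rw [h1, numIco_comp_perm Q c h2]

/-- In a sorted block the entries with an increasing property come first. -/
lemma SortedOn.numIco_eq_min {p ℓ k : ℕ} {c : ℕ → γ} (h : SortedOn p ℓ c) {Q : γ → Prop}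
    (hQ : ∀ a b, a ≤ b → Q a → Q b) (hk : k ≤ ℓ) :
    numIco Q c p (p + k) = min k (numIco Q c p (p + ℓ)) := by
  have hadd := numIco_add Q c (a := p) (b := p + k) (d := p + ℓ) (by omega) (by omega)
  by_cases hall : ∀ j, p ≤ j → j < p + k → Q (c j)
  · have := numIco_eq_iff.2 hall
    omega
  · push Not at hall
    obtain ⟨j, hj, hjk, hQj⟩ := hall
    have h0 : numIco Q c (p + k) (p + ℓ) = 0 :=
      numIco_eq_zero fun i hi hi' hQi => hQj (hQ _ _ (h j i hj (by omega) hi') hQi)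
    have := numIco_le Q c p (p + k)
    omega

/-- Thresholds recover a sorted block from its level counts, which sorting preserves. -/
lemma SortedOn.le_iff {p ℓ i : ℕ} {c : ℕ → γ} (h : SortedOn p ℓ c) (hi : i < ℓ) (θ : γ) :
    θ ≤ c (p + i) ↔ i < numIco (θ ≤ ·) c p (p + ℓ) := by
  have h1 := h.numIco_eq_min (Q := (θ ≤ ·)) (fun a b hab ha => le_trans ha hab)
    (show i + 1 ≤ ℓ by omega)
  have h2 : numIco (θ ≤ ·) c p (p + (i + 1)) = i + 1 ↔ θ ≤ c (p + i) := by
    have h3 := numIco_eq_iff (Q := (θ ≤ ·)) (c := c) (a := p) (b := p + (i + 1))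
    rw [Nat.add_sub_cancel_left] at h3
    rw [h3]
    refine ⟨fun H => H _ (by omega) (by omega), fun H j hj hj' => ?_⟩
    exact H.trans (h j (p + i) hj (by omega) (by omega))
  rw [← h2, h1]
  omega

/-- Sorting reverses the order of an increasing block. -/
lemma act_sortBlock_of_monotone {p ℓ j : ℕ} {c : ℕ → γ}
    (hc : ∀ a b, p ≤ a → a ≤ b → b < p + ℓ → c a ≤ c b) (hj : p ≤ j) (hj' : j < p + ℓ) :
    act sortEdge (sortBlock p ℓ) c j = c (2 * p + ℓ - 1 - j) := by
  classical
  let c' : ℕ → γ := fun j => c (2 * p + ℓ - 1 - j)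
  have h1 := sortedOn_act_sortBlock p ℓ c
  have h2 : SortedOn p ℓ c' := fun a b ha hab hb => hc _ _ (by omega) (by omega) (by omega)
  have h3 : ∀ Q : γ → Prop, numIco Q c' p (p + ℓ) = numIco Q c p (p + ℓ) := by
    intro Q
    unfold numIco
    refine Finset.card_nbij' (fun j => 2 * p + ℓ - 1 - j) (fun j => 2 * p + ℓ - 1 - j) ?_ ?_ ?_ ?_
    · intro a ha
      simp only [Finset.coe_filter, Finset.mem_Ico, Set.mem_ofPred_eq, c'] at ha ⊢
      exact ⟨by omega, ha.2⟩
    · intro a ha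
      simp only [Finset.coe_filter, Finset.mem_Ico, Set.mem_ofPred_eq, c'] at ha ⊢
      refine ⟨by omega, ?_⟩
      rw [show 2 * p + ℓ - 1 - (2 * p + ℓ - 1 - a) = a by omega]
      exact ha.2
    · intro a ha
      simp only [Finset.coe_filter, Finset.mem_Ico, Set.mem_ofPred_eq] at ha
      dsimp only
      omega
    · intro a ha
      simp only [Finset.coe_filter, Finset.mem_Ico, Set.mem_ofPred_eq] at ha
      dsimp only
      omega
  obtain ⟨i, rfl⟩ := Nat.exists_eq_add_of_le hj
  -- The sorted block and the reversed block are both decreasing with the same level counts, hence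
  -- equal.
  have h4 : ∀ θ, θ ≤ act sortEdge (sortBlock p ℓ) c (p + i) ↔ θ ≤ c' (p + i) := fun θ => by
    rw [h1.le_iff (by omega), h2.le_iff (by omega), h3, numIco_act_sortBlock]
  exact le_antisymm ((h4 _).1 le_rfl) ((h4 _).2 le_rfl)

end Sorting

/-- The contents of the positive sites. -/
def positivePart (η : Config) : ℕ → ℕ∞ := fun i => η (pos i)

lemma pos_inj {i j : ℕ} : pos i = pos j ↔ i = j := by
  rw [site_eq_iff, coe_pos, coe_pos]; omega

lemma positivePart_update_succ (k : ℕ) (η : Config) :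
    positivePart (update (k + 1) η) = sortEdge k (positivePart η) := by
  ext1 j
  have e1 : ∀ i j, pos i ≠ neg j := fun i j => by
    rw [Ne, site_eq_iff, coe_neg, coe_pos]; omega
  simp only [positivePart, update_succ_apply, sortEdge, pos_inj, e1, if_false]

lemma positivePart_act (l : List ℕ) (η : Config) :
    positivePart (act update (l.map (· + 1)) η) = act sortEdge l (positivePart η) := by
  induction l generalizing η with
  | nil => rfl
  | cons k l ih => rw [List.map_cons, act_cons, ih, positivePart_update_succ, act_cons]

lemma act_update_of_const_neg (l : List ℕ) {η : Config} {a : ℕ∞} (h : ∀ k, η (neg k) = a)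
    (j : ℕ) : act update (l.map (· + 1)) η (neg j) = a := by
  induction l generalizing η with
  | nil => exact h j
  | cons k l ih =>
    rw [List.map_cons, act_cons]
    refine ih fun i => ?_
    have e1 : ∀ i j, neg i ≠ pos j := fun i j => by
      rw [Ne, site_eq_iff, coe_neg, coe_pos]; omega
    simp only [update_succ_apply, e1, if_false, h, max_self, min_self, ite_self]


/-! ### The two-shock conditions as words of sorts, and hole counts. -/

section Combinatorics

/-- The edges that turn the packed initial conditions into the two-shock ones. -/
def shockSort (N M : ℕ) : List ℕ := sortBlock M (2 * N + M + 1) ++ sortBlock 0 (M + N)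

/-- The sorted version of the initial condition `twoShockTilde`. -/
noncomputable def packedTilde (N M : ℕ) : Config := fun x =>
  if (x : ℤ) ≤ -1 then 1 else if (x : ℤ) ≤ M then 2 else if (x : ℤ) ≤ M + N + 1 then 3 else ⊤

/-- The sorted version of the initial condition `twoShock`. -/
noncomputable def packed (N M : ℕ) : Config := fun x =>
  if (x : ℤ) ≤ M + N then 1 else if (x : ℤ) = M + N + 1 then 2 else ⊤

lemma monotone_packedTilde (N M : ℕ) : Monotone (packedTilde N M) := by
  intro x y hxy
  rw [← Subtype.coe_le_coe] at hxy
  unfold packedTilde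
  have h13 : (1 : ℕ∞) ≤ 3 := by norm_num
  have h23 : (2 : ℕ∞) ≤ 3 := by norm_num
  split_ifs <;> first | exact le_top | exact le_rfl | exact one_le_two | exact h13 | exact h23 | omega

lemma monotone_packed (N M : ℕ) : Monotone (packed N M) := by
  intro x y hxy
  rw [← Subtype.coe_le_coe] at hxy
  unfold packed
  split_ifs <;> first | exact le_top | exact le_rfl | exact one_le_two | omega

lemma monotone_stepInit : Monotone stepInit := by
  intro x y hxy
  rw [← Subtype.coe_le_coe] at hxy
  unfold stepInit
  split_ifs <;> first | exact le_top | exact le_rfl | omega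

lemma act_shockSort {N M : ℕ} {c : ℕ → ℕ∞} (hc : Monotone c) (hc' : ∀ i, M + N + 1 ≤ i → c i = ⊤)
    (j : ℕ) : act sortEdge (shockSort N M) c j = if j < N then ⊤ else
      if j < M + N then c (M + N - 1 - j) else
      if j < 2 * M + 2 * N + 1 then c (3 * M + 2 * N - j) else ⊤ := by
  rw [shockSort, act_append]
  set d := act sortEdge (sortBlock M (2 * N + M + 1)) c with hd
  have hd1 : ∀ i, M ≤ i → i < 2 * M + 2 * N + 1 → d i = c (3 * M + 2 * N - i) := by
    intro i hi hi'
    rw [hd, act_sortBlock_of_monotone (fun a b _ hab _ => hc hab) hi (by omega)]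
    congr 1
    omega
  have hd2 : ∀ i, i < M ∨ 2 * M + 2 * N + 1 ≤ i → d i = c i := fun i hi =>
    act_sortBlock_of_notMem c (by omega)
  have hd3 : ∀ i, M ≤ i → i < M + N → d i = ⊤ := fun i hi hi' => by
    rw [hd1 i hi (by omega), hc' _ (by omega)]
  -- The first reversal brings holes to `[M, M + N)`, so the block `[0, M + N)` is still increasing
  -- and the second sort reverses it as well.
  have hdm : ∀ a b, 0 ≤ a → a ≤ b → b < 0 + (M + N) → d a ≤ d b := by
    intro a b _ hab hb
    by_cases hbM : b < M
    · rw [hd2 a (by omega), hd2 b (by omega)]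
      exact hc hab
    · rw [hd3 b (by omega) (by omega)]
      exact le_top
  split_ifs with h1 h2 h3
  · rw [act_sortBlock_of_monotone hdm (by omega) (by omega), hd3 _ (by omega) (by omega)]
  · rw [act_sortBlock_of_monotone hdm (by omega) (by omega), hd2 _ (by omega)]
    congr 1
    omega
  · rw [act_sortBlock_of_notMem d (by omega), hd1 j (by omega) h3]
  · rw [act_sortBlock_of_notMem d (by omega), hd2 j (by omega), hc' j (by omega)]

lemma monotone_pos : Monotone pos := by
  intro i j hij
  rw [← Subtype.coe_le_coe, coe_pos, coe_pos]
  omega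

lemma act_packedTilde (N M : ℕ) :
    act update ((shockSort N M).map (· + 1)) (packedTilde N M) = twoShockTilde N M := by
  ext1 x
  rcases site_cases x with ⟨j, rfl⟩ | ⟨j, rfl⟩
  · have h := congrFun (positivePart_act (shockSort N M) (packedTilde N M)) j
    have hm : Monotone (positivePart (packedTilde N M)) := (monotone_packedTilde N M).comp monotone_pos
    rw [act_shockSort hm] at h
    · refine h.trans ?_
      have e1 := coe_pos j
      have e2 := coe_pos (M + N - 1 - j)
      have e3 := coe_pos (3 * M + 2 * N - j)
      simp only [positivePart, packedTilde, twoShockTilde]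
      split_ifs <;> first | rfl | omega
    · intro i hi
      have e1 := coe_pos i
      simp only [positivePart, packedTilde]
      split_ifs <;> first | rfl | omega
  · have hn : ∀ k, packedTilde N M (neg k) = 1 := fun k => by
      rw [packedTilde, if_pos]; rw [coe_neg]; omega
    rw [act_update_of_const_neg _ hn, twoShockTilde, if_pos]
    rw [coe_neg]; omega

lemma act_packed (N M : ℕ) :
    act update ((shockSort N M).map (· + 1)) (packed N M) = twoShock N M := by
  ext1 x
  rcases site_cases x with ⟨j, rfl⟩ | ⟨j, rfl⟩
  · have h := congrFun (positivePart_act (shockSort N M) (packed N M)) j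
    have hm : Monotone (positivePart (packed N M)) := (monotone_packed N M).comp monotone_pos
    rw [act_shockSort hm] at h
    · refine h.trans ?_
      have e1 := coe_pos j
      have e2 := coe_pos (M + N - 1 - j)
      have e3 := coe_pos (3 * M + 2 * N - j)
      simp only [positivePart, packed, twoShock]
      split_ifs <;> first | rfl | omega
    · intro i hi
      have e1 := coe_pos i
      simp only [positivePart, packed]
      split_ifs <;> first | rfl | omega
  · have hn : ∀ k, packed N M (neg k) = 1 := fun k => by
      rw [packed, if_pos]; rw [coe_neg]; omega
    rw [act_update_of_const_neg _ hn, twoShock, if_pos]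
    rw [coe_neg]; omega

lemma reverse_map_shockSort (N M : ℕ) : ((shockSort N M).map (· + 1)).reverse =
    (sortBlock 0 (M + N) ++ sortBlock M (2 * N + M + 1)).map (· + 1) := by
  rw [← List.map_reverse, shockSort, List.reverse_append, reverse_sortBlock, reverse_sortBlock]

/-- The sequence obtained from `c` by sorting the block `[0, M + N)` and then the block
`[M, 2 * M + 2 * N + 1)`. -/
def twoSorts (N M : ℕ) (c : ℕ → ℕ∞) : ℕ → ℕ∞ :=
  act sortEdge (sortBlock 0 (M + N) ++ sortBlock M (2 * N + M + 1)) c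

/-- The first sort packs the holes of `[0, M + N)` to the left, and the second does not touch `[0,
M)`. -/
lemma numIco_twoSorts_left (N M : ℕ) (c : ℕ → ℕ∞) :
    numIco (· = ⊤) (twoSorts N M c) 0 M = min M (numIco (· = ⊤) c 0 (M + N)) := by
  have h1 := (sortedOn_act_sortBlock 0 (M + N) c).numIco_eq_min (Q := (· = ⊤))
    (fun a b hab ha => top_le_iff.1 (ha ▸ hab)) (Nat.le_add_right M N)
  rw [numIco_act_sortBlock, zero_add, zero_add] at h1
  rw [← h1, twoSorts, act_append]
  exact numIco_congr fun j _ hj => by rw [act_sortBlock_of_notMem _ (.inl hj)]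

/-- The holes of the first block that do not fit into `[0, M)` spill into `[M, M + N)`, join those
further right, and are packed to the left by the second sort. -/
lemma numIco_twoSorts_right (N M : ℕ) (c : ℕ → ℕ∞) :
    numIco (· = ⊤) (twoSorts N M c) M (M + N + 1) =
      min (N + 1) (numIco (· = ⊤) c 0 (M + N) - min M (numIco (· = ⊤) c 0 (M + N)) +
        numIco (· = ⊤) c (M + N) (2 * M + 2 * N + 1)) := by
  set d := act sortEdge (sortBlock 0 (M + N)) c with hd
  have hQ : ∀ a b : ℕ∞, a ≤ b → a = ⊤ → b = ⊤ := fun a b hab ha => top_le_iff.1 (ha ▸ hab)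
  have h1 := (sortedOn_act_sortBlock 0 (M + N) c).numIco_eq_min hQ (Nat.le_add_right M N)
  have h2 := numIco_act_sortBlock 0 (M + N) (· = ⊤) c
  rw [numIco_act_sortBlock] at h1
  have h3 : numIco (· = ⊤) d (M + N) (2 * M + 2 * N + 1) =
      numIco (· = ⊤) c (M + N) (2 * M + 2 * N + 1) :=
    numIco_congr fun j hj _ => by rw [hd, act_sortBlock_of_notMem _ (.inr (by omega))]
  have h4 := (sortedOn_act_sortBlock M (2 * N + M + 1) d).numIco_eq_min hQ
    (show N + 1 ≤ 2 * N + M + 1 by omega)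
  rw [numIco_act_sortBlock] at h4
  have h5 := numIco_add (· = ⊤) d (show 0 ≤ M by omega) (show M ≤ M + N by omega)
  have h6 := numIco_add (· = ⊤) d (show M ≤ M + N by omega)
    (show M + N ≤ 2 * M + 2 * N + 1 by omega)
  rw [← hd, zero_add, zero_add] at h1
  rw [← hd, zero_add] at h2
  rw [show M + (2 * N + M + 1) = 2 * M + 2 * N + 1 by ring, ← add_assoc] at h4
  rw [twoSorts, act_append, ← hd, h4, ← h6, h3]
  omega

/-- The second block ends up with its holes first, so a hole at index `M + N` forces holes at all `N
+ 1` indices from `M` on. -/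
lemma twoSorts_eq_top_iff (N M : ℕ) (c : ℕ → ℕ∞) : twoSorts N M c (M + N) = ⊤ ↔
    numIco (· = ⊤) (twoSorts N M c) M (M + N + 1) = N + 1 := by
  have h := numIco_eq_iff (Q := (· = (⊤ : ℕ∞))) (c := twoSorts N M c) (a := M) (b := M + N + 1)
  rw [show M + N + 1 - M = N + 1 by omega] at h
  rw [h]
  refine ⟨fun H j hj hj' => ?_, fun H => H _ (by omega) (by omega)⟩
  rw [twoSorts, act_append] at H ⊢
  exact top_le_iff.1 (H ▸ sortedOn_act_sortBlock M (2 * N + M + 1) _ j (M + N) hj (by omega)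
    (by omega))

lemma pos_injective : Function.Injective pos := fun _ _ h => pos_inj.1 h

lemma stepInit_eq_top_iff {x : Site} : stepInit x = ⊤ ↔ 1 ≤ (x : ℤ) := by
  have := x.2
  unfold stepInit
  split_ifs with h
  · exact iff_of_false (by simp) (by omega)
  · exact iff_of_true rfl (by omega)

lemma stepInit_eq_one_iff {x : Site} : stepInit x = 1 ↔ (x : ℤ) ≤ -1 := by
  unfold stepInit
  split_ifs with h
  · exact iff_of_true rfl h
  · exact iff_of_false (by simp) h

/-- The positive part of the step configuration rearranged by `w`. -/
noncomputable def stepRow (w : signedPerm) : ℕ → ℕ∞ := positivePart (project stepInit w)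

lemma stepRow_eq_top_iff {w : signedPerm} {j : ℕ} : stepRow w j = ⊤ ↔ 1 ≤ (w.1 (pos j) : ℤ) :=
  stepInit_eq_top_iff

lemma stepRow_eq_one_iff {w : signedPerm} {j : ℕ} : stepRow w j = 1 ↔ (w.1 (pos j) : ℤ) ≤ -1 :=
  stepInit_eq_one_iff

lemma stepRow_act (N M : ℕ) (w : signedPerm) :
    stepRow (act sortRight ((shockSort N M).map (· + 1)).reverse w) =
      twoSorts N M (stepRow w) := by
  rw [stepRow, act_comp (φ := project stepInit)
    (fun k w => project_sortRight monotone_stepInit k w), reverse_map_shockSort, positivePart_act]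
  rfl

lemma count_pos (i : ℕ∞) (a : ℕ) (η : Config) :
    count i (a + 1) η = ({j : ℕ | a ≤ j ∧ positivePart η j = i}.ncard : ℤ) := by
  rw [count, ← Set.ncard_image_of_injective _ pos_injective]
  congr 2
  ext x
  constructor
  · rintro ⟨h1, h2⟩
    rcases site_cases x with ⟨j, rfl⟩ | ⟨j, rfl⟩
    · rw [coe_pos] at h1
      exact ⟨j, ⟨by omega, h2⟩, rfl⟩
    · rw [coe_neg] at h1
      omega
  · rintro ⟨j, ⟨h1, h2⟩, rfl⟩
    exact ⟨by rw [coe_pos]; omega, h2⟩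

lemma finite_stepRow_eq_one (w : signedPerm) : {j : ℕ | stepRow w j = 1}.Finite := by
  refine (w.2.2.preimage pos_injective.injOn).subset fun j hj h => ?_
  have h1 := stepRow_eq_one_iff.1 hj
  rw [h, coe_pos] at h1
  omega

/-- The number of particles between two sites in terms of the number of holes. -/
lemma count_sub_count (w : signedPerm) {a b : ℕ} (hab : a ≤ b) :
    count 1 (a + 1) (project stepInit w) - count 1 (b + 1) (project stepInit w) =
      (b : ℤ) - a - numIco (· = ⊤) (stepRow w) a b := by
  -- `ncard` is additive only for finite sets; finiteness comes from the finite support of `w`.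
  have hfin := finite_stepRow_eq_one w
  have h1 := numIco_add_numIco_not (· = ⊤) (stepRow w) a b
  have h1' : numIco (fun x => ¬ x = ⊤) (stepRow w) a b =
      {j : ℕ | (a ≤ j ∧ j < b) ∧ stepRow w j = 1}.ncard := by
    rw [numIco_eq_ncard]
    congr 1
    ext j
    have := (w.1 (pos j)).2
    refine and_congr_right fun _ => ?_
    rw [stepRow_eq_top_iff, stepRow_eq_one_iff]
    omega
  have h2 : {j : ℕ | a ≤ j ∧ stepRow w j = 1} = {j : ℕ | (a ≤ j ∧ j < b) ∧ stepRow w j = 1} ∪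
      {j : ℕ | b ≤ j ∧ stepRow w j = 1} := by
    ext j
    simp only [Set.mem_ofPred_eq, Set.mem_union]
    constructor
    · rintro ⟨h3, h4⟩
      by_cases h5 : j < b
      · exact .inl ⟨⟨h3, h5⟩, h4⟩
      · exact .inr ⟨by omega, h4⟩
    · rintro (⟨⟨h3, -⟩, h4⟩ | ⟨h3, h4⟩)
      · exact ⟨h3, h4⟩
      · exact ⟨by omega, h4⟩
  have h3 : {j : ℕ | a ≤ j ∧ stepRow w j = 1}.ncard =
      {j : ℕ | (a ≤ j ∧ j < b) ∧ stepRow w j = 1}.ncard +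
      {j : ℕ | b ≤ j ∧ stepRow w j = 1}.ncard := by
    rw [h2, Set.ncard_union_eq _ (hfin.subset fun j hj => hj.2) (hfin.subset fun j hj => hj.2)]
    rw [Set.disjoint_left]
    intro j hj hj'
    simp only [Set.mem_ofPred_eq] at hj hj'
    omega
  rw [count_pos, count_pos]
  change (({j : ℕ | a ≤ j ∧ stepRow w j = 1}.ncard : ℕ) : ℤ) -
    ({j : ℕ | b ≤ j ∧ stepRow w j = 1}.ncard : ℕ) = _
  omega

/-- Substituting `z = w x` passes from positions in the inverse to values of `w`. A value `≥ 1` at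
`x` is exactly a hole of the projected step configuration. -/
lemma count_project_inv (φ : Site → ℕ∞) (i : ℕ∞) (w : signedPerm) :
    count i 1 (project φ w⁻¹) = ({x : Site | φ x = i ∧ 1 ≤ (w.1 x : ℤ)}.ncard : ℤ) := by
  rw [count, ← Set.ncard_image_of_injective {x : Site | φ x = i ∧ 1 ≤ (w.1 x : ℤ)} w.1.injective]
  congr 2
  ext z
  constructor
  · rintro ⟨h1, h2⟩
    exact ⟨w.1⁻¹ z, ⟨h2, by rwa [perm_apply_inv]⟩, perm_apply_inv _ _⟩
  · rintro ⟨x, ⟨h1, h2⟩, rfl⟩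
    exact ⟨h2, by change φ (w.1⁻¹ (w.1 x)) = i; rwa [perm_inv_apply]⟩

lemma count_project_inv_of_Ico {φ : Site → ℕ∞} {i : ℕ∞} {a b : ℕ}
    (h : ∀ x : Site, φ x = i ↔ (a : ℤ) + 1 ≤ x ∧ (x : ℤ) ≤ b) (w : signedPerm) :
    count i 1 (project φ w⁻¹) = numIco (· = ⊤) (stepRow w) a b := by
  rw [count_project_inv, numIco_eq_ncard, ← Set.ncard_image_of_injective
    {j : ℕ | (a ≤ j ∧ j < b) ∧ stepRow w j = ⊤} pos_injective]
  congr 2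
  ext x
  constructor
  · rintro ⟨h1, h2⟩
    rw [h] at h1
    rcases site_cases x with ⟨j, rfl⟩ | ⟨j, rfl⟩
    · rw [coe_pos] at h1
      exact ⟨j, ⟨by omega, stepRow_eq_top_iff.2 h2⟩, rfl⟩
    · rw [coe_neg] at h1
      omega
  · rintro ⟨j, ⟨h1, h2⟩, rfl⟩
    exact ⟨(h _).2 (by rw [coe_pos]; omega), stepRow_eq_top_iff.1 h2⟩

/-- By mirror symmetry, the negative sites sent to the positive side correspond to the positive
sites sent to the negative side, which carry the step particles. -/
lemma count_project_inv_of_neg {φ : Site → ℕ∞} {i : ℕ∞} (h : ∀ x : Site, φ x = i ↔ (x : ℤ) ≤ -1)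
    (w : signedPerm) : count i 1 (project φ w⁻¹) = ({j : ℕ | stepRow w j = 1}.ncard : ℤ) := by
  have hw := w.2.1
  rw [count_project_inv,
    ← Set.ncard_image_of_injective {j | stepRow w j = 1} (mirror.injective.comp pos_injective)]
  congr 2
  ext x
  constructor
  · rintro ⟨h1, h2⟩
    rw [h] at h1
    rcases site_cases x with ⟨j, rfl⟩ | ⟨j, rfl⟩
    · rw [coe_pos] at h1
      omega
    · refine ⟨j, stepRow_eq_one_iff.2 ?_, mirror_pos j⟩
      rw [← mirror_pos, hw, coe_mirror] at h2
      omega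
  · rintro ⟨j, hj, rfl⟩
    have h1 := stepRow_eq_one_iff.1 hj
    refine ⟨(h _).2 ?_, ?_⟩
    · rw [Function.comp_apply, mirror_pos, coe_neg]; omega
    · rw [Function.comp_apply, hw, coe_mirror]; omega

lemma ncard_twoSorts (N M : ℕ) (c : ℕ → ℕ∞) (i : ℕ∞) :
    {j : ℕ | twoSorts N M c j = i}.ncard = {j : ℕ | c j = i}.ncard := by
  obtain ⟨σ, h, -⟩ := exists_perm_act 0 (2 * M + 2 * N + 1)
    (l := sortBlock 0 (M + N) ++ sortBlock M (2 * N + M + 1)) (fun k hk => by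
      rcases List.mem_append.1 hk with hk | hk
      · have := mem_sortBlock hk; omega
      · have := mem_sortBlock hk; omega) c
  rw [twoSorts, h, ← Set.ncard_image_of_injective _ σ.injective]
  congr 1
  ext j
  constructor
  · rintro ⟨k, hk, rfl⟩
    exact hk
  · intro hj
    exact ⟨σ.symm j, by simpa using hj, by simp⟩

/-- The numbers of particles of the three colors in terms of the step process. -/
lemma counts_project_packedTilde (N M : ℕ) (w : signedPerm) :
    let w' := act sortRight ((shockSort N M).map (· + 1)).reverse w
    let K : ℕ∞ → ℤ := fun i => count i 1 (project (packedTilde N M) w'⁻¹)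
    let 𝒩 : ℤ → ℤ := fun x => count 1 x (project stepInit w)
    (K 1, K 2, K 3) = (𝒩 1, min (M : ℤ) (M + N - 𝒩 1 + 𝒩 (M + N + 1)),
      min ((N : ℤ) + 1) (M + N + 1 - 𝒩 (M + N + 1) + 𝒩 (2 * M + 2 * N + 2)
        + max 0 (N - 𝒩 1 + 𝒩 (M + N + 1)))) := by
  intro w' K 𝒩
  have hrow : stepRow w' = twoSorts N M (stepRow w) := stepRow_act N M w
  have hφ1 : ∀ x : Site, packedTilde N M x = 1 ↔ (x : ℤ) ≤ -1 := fun x => by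
    have := x.2
    unfold packedTilde
    split_ifs <;> simp [*]
  have hφ2 : ∀ x : Site, packedTilde N M x = 2 ↔ ((0 : ℕ) : ℤ) + 1 ≤ x ∧ (x : ℤ) ≤ M := fun x => by
    have := x.2
    unfold packedTilde
    split_ifs
    · exact iff_of_false (by norm_num) (by omega)
    · exact iff_of_true rfl (by omega)
    · exact iff_of_false (by norm_num) (by omega)
    · exact iff_of_false (by simp) (by omega)
  have hφ3 : ∀ x : Site, packedTilde N M x = 3 ↔
      (M : ℤ) + 1 ≤ x ∧ (x : ℤ) ≤ (M + N + 1 : ℕ) := fun x => by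
    have := x.2
    unfold packedTilde
    push_cast
    split_ifs
    · exact iff_of_false (by norm_num) (by omega)
    · exact iff_of_false (by norm_num) (by omega)
    · exact iff_of_true rfl (by omega)
    · exact iff_of_false (by simp) (by omega)
  have e1 : K 1 = 𝒩 1 := by
    have h := count_pos 1 0 (project stepInit w)
    rw [Nat.cast_zero, zero_add] at h
    simp only [K, 𝒩]
    rw [count_project_inv_of_neg hφ1, hrow, ncard_twoSorts, h]
    simp [stepRow]
  have e2 : K 2 = min (M : ℤ) (numIco (· = ⊤) (stepRow w) 0 (M + N)) := by
    simp only [K]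
    rw [count_project_inv_of_Ico hφ2, hrow, numIco_twoSorts_left]
    push_cast
    rfl
  have e3 : K 3 = numIco (· = ⊤) (twoSorts N M (stepRow w)) M (M + N + 1) := by
    simp only [K]
    rw [count_project_inv_of_Ico hφ3, hrow]
  -- Hole counts are exchanged for particle counts; what remains is arithmetic with `min` and `max`.
  have d1 := count_sub_count w (show 0 ≤ M + N by omega)
  have d2 := count_sub_count w (show M + N ≤ 2 * M + 2 * N + 1 by omega)
  push_cast at d1 d2
  try rw [zero_add] at d1
  rw [show (2 : ℤ) * M + 2 * N + 1 + 1 = 2 * M + 2 * N + 2 by ring] at d2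
  have d1' : 𝒩 1 - 𝒩 (M + N + 1) = M + N - 0 - numIco (· = ⊤) (stepRow w) 0 (M + N) := d1
  have d2' : 𝒩 (M + N + 1) - 𝒩 (2 * M + 2 * N + 2) = 2 * M + 2 * N + 1 - (M + N) -
    numIco (· = ⊤) (stepRow w) (M + N) (2 * M + 2 * N + 1) := d2
  refine Prod.ext e1 (Prod.ext ?_ ?_)
  · change K 2 = _
    rw [e2]
    dsimp only
    omega
  · change K 3 = _
    rw [e3, numIco_twoSorts_right]
    dsimp only
    omega

/-- The position of the second class particle in terms of the step process. -/
lemma exists_neg_project_packed (N M : ℕ) (w : signedPerm) :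
    let w' := act sortRight ((shockSort N M).map (· + 1)).reverse w
    let 𝒩 : ℤ → ℤ := fun x => count 1 x (project stepInit w)
    (∃ x : Site, (x : ℤ) < 0 ∧ project (packed N M) w'⁻¹ x = 2) ↔
      (N : ℤ) + M + 1 ≤ 𝒩 (N + M + 1) - 𝒩 (2 * N + 2 * M + 2)
          + min (N : ℤ) (𝒩 1 - 𝒩 (N + M + 1)) := by
  intro w' 𝒩
  have hrow : stepRow w' = twoSorts N M (stepRow w) := stepRow_act N M w
  have hφ : ∀ x : Site, packed N M x = 2 ↔ x = pos (M + N) := fun x => by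
    unfold packed
    rw [site_eq_iff, coe_pos]
    push_cast
    split_ifs
    · exact iff_of_false (by norm_num) (by omega)
    · exact iff_of_true rfl (by omega)
    · exact iff_of_false (by simp) (by omega)
  -- The only site of color `2` is the value of `w'` at `pos (M + N)`, which is negative exactly
  -- when the step row of `w'` has a particle there.
  have h1 : (∃ x : Site, (x : ℤ) < 0 ∧ project (packed N M) w'⁻¹ x = 2) ↔
      ¬ stepRow w' (M + N) = ⊤ := by
    rw [stepRow_eq_top_iff]
    have hne := (w'.1 (pos (M + N))).2
    constructor
    · rintro ⟨x, hx, h⟩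
      have h2 : w'.1⁻¹ x = pos (M + N) := (hφ _).1 h
      rw [← h2, perm_apply_inv]
      omega
    · intro h
      refine ⟨w'.1 (pos (M + N)), by omega, (hφ _).2 ?_⟩
      exact perm_inv_apply _ _
  have hle := numIco_le (· = ⊤) (twoSorts N M (stepRow w)) M (M + N + 1)
  rw [h1, hrow, twoSorts_eq_top_iff, numIco_twoSorts_right]
  have d1 := count_sub_count w (show 0 ≤ M + N by omega)
  have d2 := count_sub_count w (show M + N ≤ 2 * M + 2 * N + 1 by omega)
  push_cast at d1 d2
  rw [add_comm (M : ℤ) N] at d1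
  rw [show (2 : ℤ) * M + 2 * N + 1 + 1 = 2 * N + 2 * M + 2 by ring, add_comm (M : ℤ) N] at d2
  have d1' : 𝒩 1 - 𝒩 (N + M + 1) = N + M - 0 - numIco (· = ⊤) (stepRow w) 0 (M + N) := d1
  have d2' : 𝒩 (N + M + 1) - 𝒩 (2 * N + 2 * M + 2) = 2 * M + 2 * N + 1 - (N + M) -
    numIco (· = ⊤) (stepRow w) (M + N) (2 * M + 2 * N + 1) := d2
  have hle' := numIco_le (· = ⊤) (stepRow w) 0 (M + N)
  omega

end Combinatorics


/-! ### Finite counts and the second class particle in the infinite system. -/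

lemma trunc_eq_of_notMem_occupied {m : ℕ} {η : Config}
    (h : η ∉ occupied {x : Site | (m : ℤ) < x} (· ≠ ⊤)) {x : Site} (hx : 1 ≤ (x : ℤ)) :
    trunc m η x = η x := by
  unfold trunc
  split_ifs with h1
  · rfl
  · by_contra h2
    refine h ⟨x, ?_, fun h3 => h2 h3.symm⟩
    rw [abs_of_nonneg (by omega)] at h1
    exact not_le.1 h1

lemma count_trunc {m : ℕ} {η : Config} (h : η ∉ occupied {x : Site | (m : ℤ) < x} (· ≠ ⊤))
    (i : ℕ∞) {x : ℤ} (hx : 1 ≤ x) : count i x (trunc m η) = count i x η := by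
  unfold count
  congr 2
  ext z
  refine and_congr_right fun hz => ?_
  rw [trunc_eq_of_notMem_occupied h (hx.trans hz)]

lemma exists_perm_update (k : ℕ) (η : Config) : ∃ σ : Equiv.Perm Site, update k η = η ∘ σ := by
  have h : ∀ (a b : Site) (η : Config), ∃ σ : Equiv.Perm Site, swapIfLT a b η = η ∘ σ := by
    intro a b η
    unfold swapIfLT
    split_ifs
    · exact ⟨_, rfl⟩
    · exact ⟨1, rfl⟩
  cases k with
  | zero => exact h _ _ η
  | succ k =>
    obtain ⟨σ, hσ⟩ := h (pos k) (pos (k + 1)) η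
    obtain ⟨τ, hτ⟩ := h (neg (k + 1)) (neg k) (swapIfLT (pos k) (pos (k + 1)) η)
    exact ⟨σ * τ, by rw [update, hτ, hσ]; rfl⟩

lemma SecondClassAt.update {η : Config} {g : Site} (h : SecondClassAt η g) (k : ℕ) :
    ∃ g', SecondClassAt (update k η) g' := by
  obtain ⟨σ, hσ⟩ := exists_perm_update k η
  refine ⟨σ.symm g, fun x => ?_⟩
  rw [hσ, Function.comp_apply, h, Equiv.eq_symm_apply]

/-- The inversion symmetry for configurations: functionals of the process started from a rearranged
packed configuration become functionals of the step process. -/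
lemma semigroup_eq_of_project (r : ℕ → ℝ) (n : ℕ) (t : ℝ) {φ : Site → ℕ∞} (hφ : Monotone φ)
    (l : List ℕ) {F G : Config → ℝ}
    (h : ∀ w, F (project φ (act sortRight l.reverse w)⁻¹) = G (project stepInit w)) :
    semigroup r update n t F (act update l φ) = semigroup r update n t G stepInit := by
  have e1 : act update l φ = project φ (act sortRight l 1) :=
    (act_comp (φ := project φ) (fun k w => project_sortRight hφ k w) l 1).symm
  rw [e1, semigroup_comp (φ := project φ) (fun k w => project_sortRight hφ k w),
    semigroup_act_sortRight]
  change _ = semigroup r update n t G (project stepInit 1)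
  rw [semigroup_comp (φ := project stepInit) (fun k w => project_sortRight monotone_stepInit k w)]
  congr 1
  ext w
  exact h w

lemma twoShockTilde_notMem_occupied {N M j : ℕ} (hj : 2 * M + 2 * N + 1 ≤ j) :
    twoShockTilde N M ∉ occupied {x : Site | (j : ℤ) < x} (· ≠ ⊤) := by
  rintro ⟨x, hx, h⟩
  simp only [Set.mem_ofPred_eq] at hx
  refine h ?_
  unfold twoShockTilde
  rw [if_neg (by omega), if_neg (by omega), if_neg (by omega)]

lemma stepInit_notMem_occupied (j : ℕ) :
    stepInit ∉ occupied {x : Site | (j : ℤ) < x} (· ≠ ⊤) := by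
  rintro ⟨x, hx, h⟩
  simp only [Set.mem_ofPred_eq] at hx
  exact h (stepInit_eq_top_iff.2 (by omega))

lemma twoShock_eq_two_iff {N M : ℕ} {x : Site} :
    twoShock N M x = 2 ↔ (x : ℤ) = N + 2 * M + 1 := by
  unfold twoShock
  split_ifs with h1 h2 h3
  · exact iff_of_false (by norm_num) (by omega)
  · exact iff_of_true rfl h2
  · exact iff_of_false (by norm_num) h2
  · exact iff_of_false (by simp) h2

lemma twoShock_notMem_occupied {N M j : ℕ} (hj : 2 * M + N + 1 ≤ j) :
    twoShock N M ∉ occupied {x : Site | (j : ℤ) < |(x : ℤ)|} (· = 2) := by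
  rintro ⟨x, hx, h⟩
  simp only [Set.mem_ofPred_eq] at hx
  rw [twoShock_eq_two_iff] at h
  rw [h, abs_of_nonneg (by positivity)] at hx
  omega

lemma secondClassAt_twoShock (N M : ℕ) : SecondClassAt (twoShock N M) (pos (N + 2 * M)) :=
  fun x => by rw [twoShock_eq_two_iff, site_eq_iff, coe_pos]; push_cast; rfl

namespace IsHalfSpaceTASEP

variable {α : ℝ} {η₀ : Config} {Ω : Type*} [mΩ : MeasurableSpace Ω] {P : Measure Ω}
  [IsProbabilityMeasure P] {ξ : ℝ≥0 → Ω → Config}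

lemma ae_finite (hξ : IsHalfSpaceTASEP α η₀ P ξ) (hα : 0 ≤ α) {x₀ : ℕ}
    (h : ∀ j, x₀ ≤ j → η₀ ∉ occupied {x : Site | (j : ℤ) < x} (· ≠ ⊤)) (t : ℝ≥0) :
    ∀ᵐ ω ∂P, {z : Site | 1 ≤ (z : ℤ) ∧ ξ t ω z ≠ ⊤}.Finite := by
  filter_upwards [hξ.ae_exists_notMem_occupied hα isExhaustion_lt h t] with ω ⟨m, hm⟩
  refine (finite_abs_le m).subset fun z hz => ?_
  by_contra h'
  refine hm ⟨z, ?_, hz.2⟩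
  simp only [Set.mem_ofPred_eq] at h' ⊢
  have := hz.1
  rwa [abs_of_nonneg (by omega), not_le] at h'

/-- Started from a configuration with exactly one second class particle, the process almost surely
has exactly one second class particle at time `t`. -/
lemma ae_existsUnique_two (hξ : IsHalfSpaceTASEP α η₀ P ξ) (hα : 0 ≤ α) {g₀ : Site}
    (hg : SecondClassAt η₀ g₀) {x₀ : ℕ}
    (h : ∀ j, x₀ ≤ j → η₀ ∉ occupied {x : Site | (j : ℤ) < |(x : ℤ)|} (· = 2)) (t : ℝ≥0) :
    ∀ᵐ ω ∂P, ∃ g, SecondClassAt (ξ t ω) g := by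
  have hr := rate_nonneg hα
  let p : Config → Prop := fun η => ∃ g, SecondClassAt η g
  have hp : ∀ k η, p η → p (update k η) := fun k η ⟨g, hg⟩ => hg.update k
  -- Clocks permute the contents, so the finite systems never have two second class particles; for a
  -- fixed pair of sites this is a local event and passes to the limit.
  have htwo : ∀ x y : Site, x ≠ y → ∀ᵐ ω ∂P, ¬ (ξ t ω x = 2 ∧ ξ t ω y = 2) := by
    intro x y hxy
    let A : Set Config := {η | η x = 2 ∧ η y = 2}
    have hA : IsLocal (A.indicator 1) := by
      refine ⟨max (|(x : ℤ)|).toNat (|(y : ℤ)|).toNat, fun η η' h => ?_⟩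
      have hx := h x (by simp)
      have hy := h y (by simp)
      have : η ∈ A ↔ η' ∈ A := by
        change (η x = 2 ∧ η y = 2) ↔ (η' x = 2 ∧ η' y = 2)
        rw [hx, hy]
      by_cases h' : η ∈ A
      · rw [Set.indicator_of_mem h', Set.indicator_of_mem (this.1 h')]; rfl
      · rw [Set.indicator_of_notMem h', Set.indicator_of_notMem (fun h => h' (this.2 h))]
    have hAm : MeasurableSet A :=
      (measurable_pi_apply x (measurableSet_singleton 2)).inter
        (measurable_pi_apply y (measurableSet_singleton 2))
    have h1 := hξ.tendsto_semigroup_of_isLocal hα hA (abs_indicator_one_le A) t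
    have h2 : ∀ n, semigroup (rate α) update n t (A.indicator 1) η₀ = 0 := by
      intro n
      rw [semigroup_congr hr hp (g := fun _ => 0) _ _ ⟨g₀, hg⟩, semigroup_const]
      rintro η ⟨g, hg⟩
      refine Set.indicator_of_notMem (fun hη => hxy ?_) _
      rw [(hg x).1 hη.1, (hg y).1 hη.2]
    simp only [h2] at h1
    have h3 := tendsto_nhds_unique h1 tendsto_const_nhds
    rw [hξ.integral_indicator_comp hAm, measureReal_eq_zero_iff] at h3
    refine measure_mono_null (fun ω hω => ?_) h3
    exact not_not.1 hω
  have hone : ∀ᵐ ω ∂P, ∃ x, ξ t ω x = 2 := by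
    have h1 : P.real {ω | ¬ ∃ x, ξ t ω x = 2} ≤ 0 := by
      refine ge_of_tendsto (tendsto_tail α t x₀) (Eventually.of_forall fun m => ?_)
      -- In a finite system, an empty window means that the second class particle lies outside it,
      -- where the tail bound applies.
      let A : Set Config := {η | η ∉ occupied (Set.univ ∩ {x : Site | |(x : ℤ)| ≤ m}) (· = 2)}
      have hAm : MeasurableSet A := (measurableSet_occupied _ _).compl
      have hA : IsLocal (A.indicator 1) := by
        have : A.indicator (1 : Config → ℝ) = fun η => 1 -
            (occupied (Set.univ ∩ {x : Site | |(x : ℤ)| ≤ m}) (· = 2)).indicator 1 η := by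
          ext η
          by_cases hη : η ∈ occupied (Set.univ ∩ {x : Site | |(x : ℤ)| ≤ m}) (· = 2)
          · rw [Set.indicator_of_mem hη, Set.indicator_of_notMem (show η ∉ A from fun h => h hη)]
            simp
          · rw [Set.indicator_of_notMem hη, Set.indicator_of_mem (show η ∈ A from hη)]
            simp
        obtain ⟨k, hk⟩ := isLocal_indicator_occupied Set.univ (· = 2) m
        refine ⟨k, fun η η' h => ?_⟩
        rw [this]
        dsimp only
        rw [hk h]
      have h2 := hξ.tendsto_semigroup_of_isLocal hα hA (abs_indicator_one_le A) t
      rw [hξ.integral_indicator_comp hAm] at h2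
      refine (measureReal_mono (s₂ := ξ t ⁻¹' A) fun ω hω => ?_).trans (le_of_tendsto h2
        (Eventually.of_forall fun n => ?_))
      · rintro ⟨x, -, hx⟩
        exact hω ⟨x, hx⟩
      · refine le_trans ?_ (semigroup_occupied_le hα isExhaustion_lt_abs h t.2 n m)
        refine semigroup_mono hr hp (abs_indicator_one_le _) (abs_indicator_one_le _) ?_ t.2
          ⟨g₀, hg⟩
        rintro η ⟨g, hg⟩
        by_cases hη : η ∈ A
        · have : η ∈ occupied {x : Site | (m : ℤ) < |(x : ℤ)|} (· = 2) := by
            refine ⟨g, ?_, (hg g).2 rfl⟩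
            by_contra h'
            simp only [Set.mem_ofPred_eq, not_lt] at h'
            exact hη ⟨g, ⟨trivial, h'⟩, (hg g).2 rfl⟩
          rw [Set.indicator_of_mem this, Set.indicator_of_mem hη]
        · rw [Set.indicator_of_notMem hη]
          exact indicator_one_nonneg _ _
    have h2 := le_antisymm h1 measureReal_nonneg
    rw [measureReal_eq_zero_iff] at h2
    exact h2
  have hall : ∀ᵐ ω ∂P, ∀ x y : Site, x ≠ y → ¬ (ξ t ω x = 2 ∧ ξ t ω y = 2) := by
    rw [ae_all_iff]
    intro x
    rw [ae_all_iff]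
    intro y
    by_cases hxy : x = y
    · exact Eventually.of_forall fun ω h => absurd hxy h
    · filter_upwards [htwo x y hxy] with ω hω _ using hω
  filter_upwards [hone, hall] with ω ⟨g, hg⟩ hω
  refine ⟨g, fun x => ⟨fun hx => ?_, fun hx => hx ▸ hg⟩⟩
  by_contra hne
  exact hω x g hne ⟨hx, hg⟩

end IsHalfSpaceTASEP

/-- Two events whose finite-system probabilities agree have the same probability. -/
lemma measure_eq_of_tendsto {Ω Ω' : Type*} [MeasurableSpace Ω] [MeasurableSpace Ω']
    {P : Measure Ω} {P' : Measure Ω'} [IsProbabilityMeasure P] [IsProbabilityMeasure P']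
    {A : Set Ω} {A' : Set Ω'} {u u' : ℕ → ℝ} (h : Tendsto u atTop (𝓝 (P.real A)))
    (h' : Tendsto u' atTop (𝓝 (P'.real A'))) (huu' : ∀ n, u n = u' n) : P A = P' A' := by
  have := tendsto_nhds_unique h (h'.congr fun n => (huu' n).symm)
  rwa [Measure.real, Measure.real,
    ENNReal.toReal_eq_toReal_iff' (measure_ne_top _ _) (measure_ne_top _ _)] at this

/-- A function to a countable type with null measurable fibers is almost everywhere measurable. -/
lemma aemeasurable_of_fibers {Ω β : Type*} [MeasurableSpace Ω] {P : Measure Ω}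
    [MeasurableSpace β] [Countable β] [MeasurableSpace.CountablyGenerated β] {f : Ω → β}
    (h : ∀ b, NullMeasurableSet (f ⁻¹' {b}) P) : AEMeasurable f P := by
  refine NullMeasurable.aemeasurable fun s _ => ?_
  have : f ⁻¹' s = ⋃ b ∈ s, f ⁻¹' {b} := by ext; simp
  rw [this]
  exact NullMeasurableSet.biUnion (Set.to_countable s) fun b _ => h b

end HalfSpaceTASEP

/-! ### Proof of the theorem. -/

theorem theorem3p3 (N M : ℕ) (hN : 0 < N) (hM : 0 < M) (α : ℝ) (hα : 0 < α) (t : ℝ≥0)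
    {Ω₁ Ω₂ Ω₃ : Type*} [MeasurableSpace Ω₁] [MeasurableSpace Ω₂] [MeasurableSpace Ω₃]
    (P₁ : Measure Ω₁) (P₂ : Measure Ω₂) (P₃ : Measure Ω₃)
    [IsProbabilityMeasure P₁] [IsProbabilityMeasure P₂] [IsProbabilityMeasure P₃]
    (ξ : ℝ≥0 → Ω₁ → HalfSpaceTASEP.Config)
    (hξ : HalfSpaceTASEP.IsHalfSpaceTASEP α (HalfSpaceTASEP.twoShock N M) P₁ ξ)
    (ξ' : ℝ≥0 → Ω₂ → HalfSpaceTASEP.Config)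
    (hξ' : HalfSpaceTASEP.IsHalfSpaceTASEP α (HalfSpaceTASEP.twoShockTilde N M) P₂ ξ')
    (η : ℝ≥0 → Ω₃ → HalfSpaceTASEP.Config)
    (hη : HalfSpaceTASEP.IsHalfSpaceTASEP α HalfSpaceTASEP.stepInit P₃ η) :
    let 𝒩 : ℤ → Ω₃ → ℤ := fun x ω => HalfSpaceTASEP.count 1 x (η t ω)
    let K : ℕ∞ → Ω₂ → ℤ := fun i ω => HalfSpaceTASEP.count i 1 (ξ' t ω)
    -- the position of the second class particle and all particle numbers are well defined
    (∀ᵐ ω ∂P₁, ∃ g : HalfSpaceTASEP.Site, HalfSpaceTASEP.SecondClassAt (ξ t ω) g) ∧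
    (∀ᵐ ω ∂P₂, {z : HalfSpaceTASEP.Site | 1 ≤ (z : ℤ) ∧ ξ' t ω z ≠ ⊤}.Finite) ∧
    (∀ᵐ ω ∂P₃, {z : HalfSpaceTASEP.Site | 1 ≤ (z : ℤ) ∧ η t ω z ≠ ⊤}.Finite) ∧
    -- the probability that the second class particle has disappeared
    P₁ {ω | ∃ g : HalfSpaceTASEP.Site,
        HalfSpaceTASEP.SecondClassAt (ξ t ω) g ∧ (g : ℤ) < 0} =
      P₃ {ω | (N : ℤ) + M + 1 ≤ 𝒩 (N + M + 1) ω - 𝒩 (2 * N + 2 * M + 2) ω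
          + min (N : ℤ) (𝒩 1 ω - 𝒩 (N + M + 1) ω)} ∧
    -- the joint law of the numbers of particles of the three colors
    IdentDistrib
      (fun ω => (K 1 ω, K 2 ω, K 3 ω))
      (fun ω => (𝒩 1 ω,
        min (M : ℤ) (M + N - 𝒩 1 ω + 𝒩 (M + N + 1) ω),
        min ((N : ℤ) + 1) (M + N + 1 - 𝒩 (M + N + 1) ω + 𝒩 (2 * M + 2 * N + 2) ω
          + max 0 (N - 𝒩 1 ω + 𝒩 (M + N + 1) ω))))
      P₂ P₃ := by
  classical
  intro 𝒩 K
  have hα' := hα.le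
  have hstep : ∀ j : ℕ, 0 ≤ j →
      HalfSpaceTASEP.stepInit ∉ HalfSpaceTASEP.occupied {x | (j : ℤ) < x} (· ≠ ⊤) :=
    fun j _ => HalfSpaceTASEP.stepInit_notMem_occupied j
  have htilde : ∀ j : ℕ, 2 * M + 2 * N + 1 ≤ j →
      HalfSpaceTASEP.twoShockTilde N M ∉
        HalfSpaceTASEP.occupied {x | (j : ℤ) < x} (· ≠ ⊤) :=
    fun j hj => HalfSpaceTASEP.twoShockTilde_notMem_occupied hj
  have hshock : ∀ j : ℕ, 2 * M + N + 1 ≤ j →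
      HalfSpaceTASEP.twoShock N M ∉
        HalfSpaceTASEP.occupied {x | (j : ℤ) < |(x : ℤ)|} (· = 2) :=
    fun j hj => HalfSpaceTASEP.twoShock_notMem_occupied hj
  have hone := hξ.ae_existsUnique_two hα' (HalfSpaceTASEP.secondClassAt_twoShock N M) hshock t
  refine ⟨hone, hξ'.ae_finite hα' htilde t, hη.ae_finite hα' hstep t, ?_, ?_⟩
  -- Bare existence of a negative site of color `2` can be read off from a window once no remote
  -- site has color `2`; uniqueness, which holds almost surely, is restored at the end.
  · let A : Set HalfSpaceTASEP.Config :=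
      {ζ | ∃ x : HalfSpaceTASEP.Site, (x : ℤ) < 0 ∧ ζ x = 2}
    let A' : Set HalfSpaceTASEP.Config := {ζ | (N : ℤ) + M + 1 ≤
      HalfSpaceTASEP.count 1 (N + M + 1) ζ - HalfSpaceTASEP.count 1 (2 * N + 2 * M + 2) ζ
        + min (N : ℤ) (HalfSpaceTASEP.count 1 1 ζ - HalfSpaceTASEP.count 1 (N + M + 1) ζ)}
    have h1 := (hξ.tendsto_semigroup_indicator hα' HalfSpaceTASEP.isExhaustion_lt_abs hshock
      (A := A) (fun m ζ hζ => exists_congr fun x => and_congr_right fun _ => by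
        unfold HalfSpaceTASEP.trunc
        split_ifs with h
        · rfl
        · refine iff_of_false (by simp) fun h2 => hζ ⟨x, not_le.1 h, h2⟩) t).2
    have h2 := (hη.tendsto_semigroup_indicator hα' HalfSpaceTASEP.isExhaustion_lt hstep
      (A := A') (fun m ζ hζ => by
        simp only [A', Set.mem_ofPred_eq]
        rw [HalfSpaceTASEP.count_trunc hζ _ (by omega), HalfSpaceTASEP.count_trunc hζ _ (by omega),
          HalfSpaceTASEP.count_trunc hζ _ (by omega)]) t).2
    have h3 : P₁ (ξ t ⁻¹' A) = P₃ (η t ⁻¹' A') := by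
      refine HalfSpaceTASEP.measure_eq_of_tendsto h1 h2 fun n => ?_
      -- The initial condition is written as a word applied to a monotone configuration, the form
      -- required by the inversion symmetry.
      rw [← HalfSpaceTASEP.act_packed]
      refine HalfSpaceTASEP.semigroup_eq_of_project _ _ _ (HalfSpaceTASEP.monotone_packed N M) _
        fun w => ?_
      have := HalfSpaceTASEP.exists_neg_project_packed N M w
      simp only [Set.indicator_apply]
      exact if_congr this rfl rfl
    refine (measure_congr ?_).trans h3
    filter_upwards [hone] with ω ⟨g, hg⟩
    refine propext ⟨fun ⟨g', h4, h5⟩ => ⟨g', h5, (h4 g').2 rfl⟩, fun ⟨x, h4, h5⟩ => ?_⟩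
    exact ⟨g, hg, (hg x).1 h5 ▸ h4⟩
  · let Φ : HalfSpaceTASEP.Config → ℤ × ℤ × ℤ := fun ζ => (HalfSpaceTASEP.count 1 1 ζ,
      HalfSpaceTASEP.count 2 1 ζ, HalfSpaceTASEP.count 3 1 ζ)
    let Ψ : HalfSpaceTASEP.Config → ℤ × ℤ × ℤ := fun ζ =>
      let 𝒞 : ℤ → ℤ := fun x => HalfSpaceTASEP.count 1 x ζ
      (𝒞 1, min (M : ℤ) (M + N - 𝒞 1 + 𝒞 (M + N + 1)),
        min ((N : ℤ) + 1) (M + N + 1 - 𝒞 (M + N + 1) + 𝒞 (2 * M + 2 * N + 2)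
          + max 0 (N - 𝒞 1 + 𝒞 (M + N + 1))))
    have h1 := fun v => hξ'.tendsto_semigroup_indicator hα' HalfSpaceTASEP.isExhaustion_lt htilde
      (A := Φ ⁻¹' {v}) (fun m ζ hζ => by
        change Φ _ = v ↔ Φ _ = v
        simp only [Φ, HalfSpaceTASEP.count_trunc hζ _ le_rfl]) t
    have h2 := fun v => hη.tendsto_semigroup_indicator hα' HalfSpaceTASEP.isExhaustion_lt hstep
      (A := Ψ ⁻¹' {v}) (fun m ζ hζ => by
        change Ψ _ = v ↔ Ψ _ = v
        simp only [Ψ]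
        rw [HalfSpaceTASEP.count_trunc hζ _ le_rfl, HalfSpaceTASEP.count_trunc hζ _ (by omega),
          HalfSpaceTASEP.count_trunc hζ _ (by omega)]) t
    have hΦ : AEMeasurable (fun ω => Φ (ξ' t ω)) P₂ :=
      HalfSpaceTASEP.aemeasurable_of_fibers fun v => (h1 v).1
    have hΨ : AEMeasurable (fun ω => Ψ (η t ω)) P₃ :=
      HalfSpaceTASEP.aemeasurable_of_fibers fun v => (h2 v).1
    -- The vectors of counts take values in a countable space, so their laws need only be compared
    -- on singletons.
    refine ⟨hΦ, hΨ, Measure.ext_of_singleton fun v => ?_⟩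
    rw [Measure.map_apply_of_aemeasurable hΦ (measurableSet_singleton v),
      Measure.map_apply_of_aemeasurable hΨ (measurableSet_singleton v)]
    refine HalfSpaceTASEP.measure_eq_of_tendsto (h1 v).2 (h2 v).2 fun n => ?_
    rw [← HalfSpaceTASEP.act_packedTilde]
    refine HalfSpaceTASEP.semigroup_eq_of_project _ _ _ (HalfSpaceTASEP.monotone_packedTilde N M) _
      fun w => ?_
    have := HalfSpaceTASEP.counts_project_packedTilde N M w
    simp only [Set.indicator_apply]
    refine if_congr ?_ rfl rfl
    change Φ _ = v ↔ Ψ _ = v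
    rw [show Φ _ = Ψ _ from this]
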